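/- Let $d\ge 2$ and let $\Omega\subset\mathbb R^d$ be a bounded domain (nonempty, open, connected; no regularity of $\partial\Omega$ is needed). Let $a_{i,j}\in L^\infty(\Omega;\mathbb R)$, $1\le i,j\le d$, satisfy $a_{i,j}=a_{j,i}$ a.e. and, for some $c>0$ and a.e. $x\in\Omega$, $\sum_{i,j}a_{i,j}(x)\xi_i\xi_j\ge c|\xi|^2$ for all $\xi\in\mathbb R^d$. Let $q\in L^\kappa(\Omega;\mathbb R)$ with $\kappa\in(d,+\infty]$ and $q\ge 0$ a.e., and let $\alpha,\rho\in L^\infty(\Omega;\mathbb R)$ satisfy, for a.e. $x\in\Omega$, $0<\alpha_0\le\alpha(x)\le\alpha_M<1$ and $0<\rho_0\le\rho(x)\le\rho_M<+\infty$ with constants $\alpha_0,\alpha_M,\rho_0,\rho_M$. Let $H^1_0(\Omega)$ be the closure of $C_c^\infty(\Omega;\mathbb C)$ in $H^1(\Omega;\mathbb C)$, and let $A_0$ be the operator in $L^2(\Omega)=L^2(\Omega;\mathbb C)$ generated by the form $a_0(u,v)=\sum_{i,j}\int_\Omega a_{i,j}\,\partial_{x_i}u\,\overline{\partial_{x_j}v}\,dx$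 on $H_0^1(\Omega)$; that is, $u\in D(A_0)$ and $A_0u=f$ if and only if $u\in H^1_0(\Omega)$, $f\in L^2(\Omega)$ and $a_0(u,v)=\langle f,v\rangle_{L^2(\Omega)}$ for all $v\in H^1_0(\Omega)$. Put $A_q:=A_0+q$, with domain $\{u\in D(A_0):\ qu\in L^2(\Omega)\}$. Powers $p^{\alpha(x)}$ are taken with the principal branch on $\mathbb C\setminus\mathbb R_-$, where $\mathbb R_-=(-\infty,0]$. Then $D(A_q)=D(A_0)$, and: 1. For every $p\in\mathbb C\setminus\mathbb R_-$, the operator $A_q+\rho(x)p^{\alpha(x)}$ is boundedly invertible in $L^2(\Omega)$, and $(A_q+\rho(x)p^{\alpha(x)})^{-1}$ maps $L^2(\Omega)$ into $D(A_0)$. 2. For all $r\in(0,+\infty)$ and $\beta\in(-\pi,\pi)$, $$\big\|(A_q+\rho(x)r^{\alpha(x)}e^{i\beta\alpha(x)})^{-1}\big\|_{\mathcal B(L^2(\Omega))}\le C(r,\beta)\max_{j=0,M}r^{-\alpha_j},$$ where $$C(r,\beta):=\begin{cases}2\rho_0^{-1},&|\beta|\le\theta_*(r),\\ \rho_0^{-1}c_*(\beta),&\text{otherwise,}\end{cases}$$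 $$\theta_*(r):=\alpha_M^{-1}\min_{\sigma=\pm1}\arctan\Big(\frac{\rho_0}{3\rho_M}r^{\sigma(\alpha_M-\alpha_0)}\Big),\qquad c_*(\beta):=\max_{j=0,M}|\sin(\alpha_j\beta)|^{-1}.$$ 3. The map $p\mapsto(A_q+\rho(x)p^{\alpha(x)})^{-1}$ is holomorphic and bounded on $\mathbb C\setminus\mathbb R_-$ with values in $\mathcal B(L^2(\Omega))$, i.e. its operator norm is bounded uniformly in $p\in\mathbb C\setminus\mathbb R_-$. -/

import Mathlib

open MeasureTheory
open scoped ENNReal ContDiff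

namespace VariableOrder

/-- `d`-dimensional Euclidean space. -/
abbrev Space (d : ℕ) : Type := EuclideanSpace ℝ (Fin d)

/-- The complex Hilbert space `L²(Ω)`. -/
abbrev L2 {d : ℕ} (Ω : Set (Space d)) : Type :=
  Lp ℂ 2 ((volume : Measure (Space d)).restrict Ω)

/-- The classical partial derivative `∂φ/∂xᵢ`. -/
noncomputable def partialDeriv {d : ℕ} (i : Fin d) (φ : Space d → ℂ) (x : Space d) : ℂ :=
  fderiv ℝ φ x (EuclideanSpace.single i (1 : ℝ))

/-- `φ ∈ C_c^∞(Ω)`. -/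
structure IsTestFunction {d : ℕ} (Ω : Set (Space d)) (φ : Space d → ℂ) : Prop where
  smooth : ContDiff ℝ ∞ φ
  compact : HasCompactSupport φ
  support_subset : tsupport φ ⊆ Ω

namespace IsTestFunction

variable {d : ℕ} {Ω : Set (Space d)} {φ ψ : Space d → ℂ}

theorem zero : IsTestFunction Ω (0 : Space d → ℂ) :=
  ⟨contDiff_const, HasCompactSupport.zero, by simp⟩

theorem add (hφ : IsTestFunction Ω φ) (hψ : IsTestFunction Ω ψ) : IsTestFunction Ω (φ + ψ) :=
  ⟨hφ.smooth.add hψ.smooth, hφ.compact.add hψ.compact,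
    (tsupport_add φ ψ).trans (Set.union_subset hφ.support_subset hψ.support_subset)⟩

theorem smul (c : ℂ) (hφ : IsTestFunction Ω φ) : IsTestFunction Ω (c • φ) :=
  ⟨contDiff_const.smul hφ.smooth, hφ.compact.smul_left (f := fun _ => c),
    (closure_mono (Function.support_const_smul_subset c φ)).trans hφ.support_subset⟩

theorem differentiable (hφ : IsTestFunction Ω φ) : Differentiable ℝ φ :=
  hφ.smooth.differentiable (by simp)

theorem continuous_partialDeriv (hφ : IsTestFunction Ω φ) (i : Fin d) :
    Continuous (partialDeriv i φ) :=
  (hφ.smooth.continuous_fderiv (by simp)).clm_apply continuous_const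

theorem compact_partialDeriv (hφ : IsTestFunction Ω φ) (i : Fin d) :
    HasCompactSupport (partialDeriv i φ) :=
  hφ.compact.fderiv_apply ℝ _

theorem support_partialDeriv (hφ : IsTestFunction Ω φ) (i : Fin d) :
    Function.support (partialDeriv i φ) ⊆ Ω := fun x hx =>
  hφ.support_subset (support_fderiv_subset ℝ (fun h => hx (by simp [partialDeriv, h])))

theorem memLp (hφ : IsTestFunction Ω φ) (p : ℝ≥0∞) (μ : Measure (Space d))
    [IsFiniteMeasureOnCompacts μ] : MemLp φ p μ :=
  hφ.smooth.continuous.memLp_of_hasCompactSupport hφ.compact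

theorem memLp_partialDeriv (hφ : IsTestFunction Ω φ) (i : Fin d) (p : ℝ≥0∞)
    (μ : Measure (Space d)) [IsFiniteMeasureOnCompacts μ] : MemLp (partialDeriv i φ) p μ :=
  (hφ.continuous_partialDeriv i).memLp_of_hasCompactSupport (hφ.compact_partialDeriv i)

theorem partialDeriv_add (hφ : IsTestFunction Ω φ) (hψ : IsTestFunction Ω ψ) (i : Fin d) :
    partialDeriv i (φ + ψ) = partialDeriv i φ + partialDeriv i ψ := by
  funext x
  simp [partialDeriv, fderiv_add (hφ.differentiable x) (hψ.differentiable x)]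

theorem partialDeriv_smul (c : ℂ) (hφ : IsTestFunction Ω φ) (i : Fin d) :
    partialDeriv i (c • φ) = c • partialDeriv i φ := by
  funext x
  simp [partialDeriv, fderiv_const_smul (hφ.differentiable x) c]

end IsTestFunction

theorem L2.integrable_mul {d : ℕ} {Ω : Set (Space d)} (u : L2 Ω) {g : Space d → ℂ}
    (hg : MemLp g 2 (volume.restrict Ω)) :
    Integrable (fun x => u x * g x) (volume.restrict Ω) :=
  (Lp.memLp u).integrable_mul hg

/-- The Sobolev space `H¹(Ω)`, realised as the space of all pairs `(u, g)` where `u ∈ L²(Ω)` and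
`g = (g₁, …, g_d)`, `gᵢ ∈ L²(Ω)`, is the weak gradient of `u`. -/
noncomputable def sobolevH1 {d : ℕ} (Ω : Set (Space d)) :
    Submodule ℂ (L2 Ω × (Fin d → L2 Ω)) where
  carrier := {w | ∀ φ : Space d → ℂ, IsTestFunction Ω φ → ∀ i : Fin d,
    ∫ x in Ω, w.1 x * partialDeriv i φ x = -∫ x in Ω, w.2 i x * φ x}
  zero_mem' := by
    intro φ _ i
    have h0 : ((0 : L2 Ω) : Space d → ℂ) =ᵐ[volume.restrict Ω] 0 := Lp.coeFn_zero _ _ _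
    have h1 : ∫ x in Ω, (0 : L2 Ω) x * partialDeriv i φ x = 0 := by
      rw [integral_congr_ae (g := fun _ => 0)]
      · simp
      · filter_upwards [h0] with x hx
        rw [hx, Pi.zero_apply, zero_mul]
    have h2 : ∫ x in Ω, (0 : L2 Ω) x * φ x = 0 := by
      rw [integral_congr_ae (g := fun _ => 0)]
      · simp
      · filter_upwards [h0] with x hx
        rw [hx, Pi.zero_apply, zero_mul]
    exact h1.trans (neg_eq_zero.mpr h2).symm
  add_mem' := by
    intro v w hv hw φ hφ i
    have key : ∀ (a b : L2 Ω) (ψ : Space d → ℂ), MemLp ψ 2 (volume.restrict Ω) →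
        ∫ x in Ω, (a + b) x * ψ x = (∫ x in Ω, a x * ψ x) + ∫ x in Ω, b x * ψ x := by
      intro a b ψ hψ
      rw [← integral_add (L2.integrable_mul a hψ) (L2.integrable_mul b hψ)]
      refine integral_congr_ae ?_
      filter_upwards [Lp.coeFn_add a b] with x hx
      rw [hx, Pi.add_apply, add_mul]
    have e1 := key v.1 w.1 _ (hφ.memLp_partialDeriv i 2 _)
    have e2 := key (v.2 i) (w.2 i) _ (hφ.memLp 2 _)
    have hv' := hv φ hφ i
    have hw' := hw φ hφ i
    change ∫ x in Ω, (v.1 + w.1) x * partialDeriv i φ x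
      = -∫ x in Ω, (v.2 i + w.2 i) x * φ x
    rw [e1, e2, hv', hw']
    ring
  smul_mem' := by
    intro c w hw φ hφ i
    have key : ∀ (a : L2 Ω) (ψ : Space d → ℂ),
        ∫ x in Ω, (c • a) x * ψ x = c * ∫ x in Ω, a x * ψ x := by
      intro a ψ
      rw [← integral_const_mul]
      refine integral_congr_ae ?_
      filter_upwards [Lp.coeFn_smul c a] with x hx
      rw [hx, Pi.smul_apply, smul_eq_mul, mul_assoc]
    have hw' := hw φ hφ i
    change ∫ x in Ω, (c • w.1) x * partialDeriv i φ x = -∫ x in Ω, (c • w.2 i) x * φ x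
    rw [key, key, hw']
    ring

/-- The space of all pairs `(φ, ∇φ)` with `φ ∈ C_c^∞(Ω)`. -/
noncomputable def testPairs {d : ℕ} (Ω : Set (Space d)) :
    Submodule ℂ (L2 Ω × (Fin d → L2 Ω)) where
  carrier := {w | ∃ φ : Space d → ℂ, IsTestFunction Ω φ ∧
    w.1 =ᵐ[volume.restrict Ω] φ ∧ ∀ i, w.2 i =ᵐ[volume.restrict Ω] partialDeriv i φ}
  zero_mem' := by
    refine ⟨0, IsTestFunction.zero, Lp.coeFn_zero _ _ _, fun i => ?_⟩
    have : partialDeriv i (0 : Space d → ℂ) = 0 := by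
      funext x
      simp [partialDeriv]
    rw [this]
    exact Lp.coeFn_zero _ _ _
  add_mem' := by
    rintro v w ⟨φ, hφ, h1, h2⟩ ⟨ψ, hψ, h3, h4⟩
    refine ⟨φ + ψ, hφ.add hψ, (Lp.coeFn_add _ _).trans (h1.add h3), fun i => ?_⟩
    rw [hφ.partialDeriv_add hψ]
    exact (Lp.coeFn_add _ _).trans ((h2 i).add (h4 i))
  smul_mem' := by
    rintro c w ⟨φ, hφ, h1, h2⟩
    refine ⟨c • φ, hφ.smul c, (Lp.coeFn_smul _ _).trans (h1.const_smul c), fun i => ?_⟩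
    rw [hφ.partialDeriv_smul]
    exact (Lp.coeFn_smul _ _).trans ((h2 i).const_smul c)

/-- The Sobolev space `H₀¹(Ω)`: the closure of `C_c^∞(Ω)` in `H¹(Ω)`; again its elements are the
pairs `(u, ∇u)`, and the topology of `L²(Ω) × L²(Ω)^d` on such pairs is that of the `H¹`-norm. -/
noncomputable def sobolevH10 {d : ℕ} (Ω : Set (Space d)) :
    Submodule ℂ (L2 Ω × (Fin d → L2 Ω)) :=
  sobolevH1 Ω ⊓ (testPairs Ω).topologicalClosure

/-- The integrand `a_{ij} gᵢ \overline{hⱼ}` of the sesquilinear form. -/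
noncomputable def formIntegrand {d : ℕ} {Ω : Set (Space d)} (a : Fin d → Fin d → Space d → ℝ)
    (g h : Fin d → L2 Ω) (i j : Fin d) (x : Space d) : ℂ :=
  (a i j x : ℂ) * g i x * (starRingEnd ℂ) (h j x)

/-- The sesquilinear form `a₀(u, v) = ∑ᵢⱼ ∫_Ω a_{ij} ∂ᵢu \overline{∂ⱼv} dx`, as a function of the
gradients `g = ∇u` and `h = ∇v`. -/
noncomputable def form {d : ℕ} {Ω : Set (Space d)} (a : Fin d → Fin d → Space d → ℝ)
    (g h : Fin d → L2 Ω) : ℂ :=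
  ∑ i, ∑ j, ∫ x in Ω, formIntegrand a g h i j x

/-- The graph of the operator generated by the form `a₀` on `H₀¹(Ω)`: all `(u, f)` with
`u ∈ H₀¹(Ω)`, `f ∈ L²(Ω)` and `a₀(u, v) = ⟨f, v⟩` for every `v ∈ H₀¹(Ω)`. (The inner product of
the library is linear in its second argument. The integrability clause is automatic for bounded
measurable coefficients; it makes the graph a subspace for any `a`.) -/
noncomputable def dirichletGraph {d : ℕ} (Ω : Set (Space d))
    (a : Fin d → Fin d → Space d → ℝ) : Submodule ℂ (L2 Ω × L2 Ω) where
  carrier := {w | ∃ g, (w.1, g) ∈ sobolevH10 Ω ∧ ∀ v h, (v, h) ∈ sobolevH10 Ω →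
    (∀ i j, Integrable (formIntegrand a g h i j) (volume.restrict Ω)) ∧
      form a g h = inner ℂ v w.2}
  zero_mem' := by
    refine ⟨0, Submodule.zero_mem _, fun v h _ => ?_⟩
    have h0 : ∀ i j, formIntegrand a (0 : Fin d → L2 Ω) h i j =ᵐ[volume.restrict Ω] 0 := by
      intro i j
      filter_upwards [Lp.coeFn_zero ℂ 2 ((volume : Measure (Space d)).restrict Ω)] with x hx
      simp only [formIntegrand, Pi.zero_apply, hx, mul_zero, zero_mul]
    refine ⟨fun i j => (integrable_zero _ _ _).congr (h0 i j).symm, ?_⟩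
    simp only [form, Prod.snd_zero, inner_zero_right]
    refine Finset.sum_eq_zero fun i _ => Finset.sum_eq_zero fun j _ => ?_
    rw [integral_congr_ae (h0 i j)]
    simp
  add_mem' := by
    rintro w w' ⟨g, hg, H⟩ ⟨g', hg', H'⟩
    refine ⟨g + g', Submodule.add_mem _ hg hg', fun v h hv => ?_⟩
    obtain ⟨I, E⟩ := H v h hv
    obtain ⟨I', E'⟩ := H' v h hv
    have h0 : ∀ i j, formIntegrand a (g + g') h i j =ᵐ[volume.restrict Ω]
        formIntegrand a g h i j + formIntegrand a g' h i j := by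
      intro i j
      filter_upwards [Lp.coeFn_add (g i) (g' i)] with x hx
      simp only [formIntegrand, Pi.add_apply, hx]
      ring
    refine ⟨fun i j => ((I i j).add (I' i j)).congr (h0 i j).symm, ?_⟩
    rw [Prod.snd_add, inner_add_right, ← E, ← E']
    simp only [form, ← Finset.sum_add_distrib]
    refine Finset.sum_congr rfl fun i _ => Finset.sum_congr rfl fun j _ => ?_
    rw [integral_congr_ae (h0 i j)]
    exact integral_add (I i j) (I' i j)
  smul_mem' := by
    rintro c w ⟨g, hg, H⟩
    refine ⟨c • g, Submodule.smul_mem _ c hg, fun v h hv => ?_⟩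
    obtain ⟨I, E⟩ := H v h hv
    have h0 : ∀ i j, formIntegrand a (c • g) h i j =ᵐ[volume.restrict Ω]
        fun x => c * formIntegrand a g h i j x := by
      intro i j
      filter_upwards [Lp.coeFn_smul c (g i)] with x hx
      simp only [formIntegrand, Pi.smul_apply, hx, smul_eq_mul]
      ring
    refine ⟨fun i j => ((I i j).const_mul c).congr (h0 i j).symm, ?_⟩
    rw [Prod.smul_snd, inner_smul_right, ← E]
    simp only [form, Finset.mul_sum]
    refine Finset.sum_congr rfl fun i _ => Finset.sum_congr rfl fun j _ => ?_
    rw [integral_congr_ae (h0 i j)]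
    exact integral_const_mul _ _

/-- The operator `A₀` in `L²(Ω)` generated by the form `a₀` on `H₀¹(Ω)`. -/
noncomputable def dirichletOperator {d : ℕ} (Ω : Set (Space d))
    (a : Fin d → Fin d → Space d → ℝ) : L2 Ω →ₗ.[ℂ] L2 Ω :=
  (dirichletGraph Ω a).toLinearPMap

/-- An `L²` function orthogonal to `C_c^∞(Ω)` vanishes. -/
theorem L2.eq_zero_of_forall_test {d : ℕ} {Ω : Set (Space d)} (hΩ : IsOpen Ω) (u : L2 Ω)
    (h : ∀ φ : Space d → ℂ, IsTestFunction Ω φ → ∫ x in Ω, u x * φ x = 0) : u = 0 := by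
  have hloc : LocallyIntegrable u (volume.restrict Ω) :=
    (Lp.memLp u).locallyIntegrable (by norm_num)
  have key := IsOpen.ae_eq_zero_of_integral_contDiff_smul_eq_zero (μ := volume.restrict Ω) hΩ
    (f := u) (hloc.locallyIntegrableOn Ω) (by
      intro g hg hgc hgs
      have ht : IsTestFunction Ω (fun x => (g x : ℂ)) := by
        refine ⟨Complex.ofRealCLM.contDiff.comp hg, hgc.comp_left Complex.ofReal_zero, ?_⟩
        refine (closure_mono fun x hx => ?_).trans hgs
        simpa using hx
      have := h _ ht
      rw [← this]
      refine integral_congr_ae (Filter.Eventually.of_forall fun x => ?_)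
      simp [mul_comm])
  rw [Lp.eq_zero_iff_ae_eq_zero]
  filter_upwards [key, ae_restrict_mem hΩ.measurableSet] with x hx hxΩ using hx hxΩ

/-- Integration by parts: a test function with its gradient is an element of `H₀¹(Ω)`. -/
theorem IsTestFunction.mem_sobolevH10 {d : ℕ} {Ω : Set (Space d)}
    {φ : Space d → ℂ} (hφ : IsTestFunction Ω φ) :
    ((hφ.memLp 2 (volume.restrict Ω)).toLp φ,
      fun i => (hφ.memLp_partialDeriv i 2 (volume.restrict Ω)).toLp (partialDeriv i φ))
        ∈ sobolevH10 Ω := by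
  refine ⟨fun ψ hψ i => ?_, Submodule.le_topologicalClosure _
    ⟨φ, hφ, (hφ.memLp 2 _).coeFn_toLp, fun i => (hφ.memLp_partialDeriv i 2 _).coeFn_toLp⟩⟩
  have hint : ∀ {f g : Space d → ℂ}, MemLp f 2 volume → MemLp g 2 volume →
      Integrable (fun x => f x * g x) volume := fun hf hg => hf.integrable_mul hg
  have e1 : ∫ x in Ω, ((hφ.memLp 2 (volume.restrict Ω)).toLp φ) x * partialDeriv i ψ x
      = ∫ x, φ x * partialDeriv i ψ x := by
    rw [← setIntegral_eq_integral_of_forall_compl_eq_zero (s := Ω)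
      (f := fun x => φ x * partialDeriv i ψ x)]
    · refine integral_congr_ae ?_
      filter_upwards [MemLp.coeFn_toLp (hφ.memLp 2 (volume.restrict Ω))] with x hx
      rw [hx]
    · intro x hx
      have : partialDeriv i ψ x = 0 := by
        by_contra h
        exact hx (hψ.support_partialDeriv i h)
      simp [this]
  have e2 : ∫ x in Ω, ((hφ.memLp_partialDeriv i 2 (volume.restrict Ω)).toLp
      (partialDeriv i φ)) x * ψ x = ∫ x, partialDeriv i φ x * ψ x := by
    rw [← setIntegral_eq_integral_of_forall_compl_eq_zero (s := Ω)
      (f := fun x => partialDeriv i φ x * ψ x)]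
    · refine integral_congr_ae ?_
      filter_upwards [MemLp.coeFn_toLp (hφ.memLp_partialDeriv i 2 (volume.restrict Ω))] with x hx
      rw [hx]
    · intro x hx
      have : partialDeriv i φ x = 0 := by
        by_contra h
        exact hx (hφ.support_partialDeriv i h)
      simp [this]
  change ∫ x in Ω, ((hφ.memLp 2 (volume.restrict Ω)).toLp φ) x * partialDeriv i ψ x
    = -∫ x in Ω, ((hφ.memLp_partialDeriv i 2 (volume.restrict Ω)).toLp
      (partialDeriv i φ)) x * ψ x
  rw [e1, e2]
  exact integral_mul_fderiv_eq_neg_fderiv_mul_of_integrable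
    (hint (hφ.memLp_partialDeriv i 2 _) (hψ.memLp 2 _))
    (hint (hφ.memLp 2 _) (hψ.memLp_partialDeriv i 2 _))
    (hint (hφ.memLp 2 _) (hψ.memLp 2 _))
    (fun x _ => hφ.differentiable x) (fun x _ => hψ.differentiable x)

/-- The weak gradient is unique. -/
theorem sobolevH1_gradient_eq_zero {d : ℕ} {Ω : Set (Space d)} (hΩ : IsOpen Ω)
    {g : Fin d → L2 Ω} (hg : ((0 : L2 Ω), g) ∈ sobolevH1 Ω) : g = 0 := by
  funext i
  refine L2.eq_zero_of_forall_test hΩ (g i) fun φ hφ => ?_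
  have h1 := hg φ hφ i
  have h2 : ∫ x in Ω, (0 : L2 Ω) x * partialDeriv i φ x = 0 := by
    rw [integral_congr_ae (g := fun _ => 0)]
    · simp
    · filter_upwards [Lp.coeFn_zero ℂ 2 ((volume : Measure (Space d)).restrict Ω)] with x hx
      rw [hx, Pi.zero_apply, zero_mul]
  exact neg_eq_zero.mp (h1.symm.trans h2)

/-- `dirichletGraph` is single-valued, hence it is the graph of `dirichletOperator`. -/
theorem dirichletOperator_graph {d : ℕ} {Ω : Set (Space d)} (hΩ : IsOpen Ω)
    (a : Fin d → Fin d → Space d → ℝ) :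
    (dirichletOperator Ω a).graph = dirichletGraph Ω a := by
  refine Submodule.toLinearPMap_graph_eq _ ?_
  rintro ⟨u, f⟩ ⟨g, hg, H⟩ (rfl : u = 0)
  have hg0 : g = 0 := sobolevH1_gradient_eq_zero hΩ hg.1
  subst hg0
  refine L2.eq_zero_of_forall_test hΩ f fun φ hφ => ?_
  have hφ' : IsTestFunction Ω (fun x => (starRingEnd ℂ) (φ x)) :=
    ⟨Complex.conjCLE.contDiff.comp hφ.smooth, hφ.compact.comp_left (map_zero _),
      (closure_mono fun x hx => by simpa using hx).trans hφ.support_subset⟩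
  have h1 := (H _ _ hφ'.mem_sobolevH10).2
  have h2 : form a (0 : Fin d → L2 Ω)
      (fun i => (hφ'.memLp_partialDeriv i 2 _).toLp (partialDeriv i _)) = 0 := by
    refine Finset.sum_eq_zero fun i _ => Finset.sum_eq_zero fun j _ => ?_
    rw [integral_congr_ae (g := fun _ => 0)]
    · simp
    · filter_upwards [Lp.coeFn_zero ℂ 2 ((volume : Measure (Space d)).restrict Ω)] with x hx
      simp only [formIntegrand, Pi.zero_apply, hx, mul_zero, zero_mul]
  rw [h2, L2.inner_def] at h1
  rw [h1]
  refine integral_congr_ae ?_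
  filter_upwards [MemLp.coeFn_toLp (hφ'.memLp 2 (volume.restrict Ω))] with x hx
  simp [hx, RCLike.inner_apply]

/-- The natural domain `{u ∈ L²(Ω) : m u ∈ L²(Ω)}` of the multiplication by the function `m`. -/
noncomputable def multiplicationDomain {d : ℕ} (Ω : Set (Space d)) (m : Space d → ℂ) :
    Submodule ℂ (L2 Ω) where
  carrier := {u | MemLp (fun x => m x * u x) 2 (volume.restrict Ω)}
  zero_mem' := by
    refine (MemLp.zero : MemLp (0 : Space d → ℂ) 2 (volume.restrict Ω)).ae_eq ?_
    filter_upwards [Lp.coeFn_zero ℂ 2 ((volume : Measure (Space d)).restrict Ω)] with x hx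
    rw [hx, Pi.zero_apply, mul_zero]
  add_mem' := by
    intro u v hu hv
    refine (MemLp.add hu hv).ae_eq ?_
    filter_upwards [Lp.coeFn_add u v] with x hx
    rw [hx, Pi.add_apply, Pi.add_apply, mul_add]
  smul_mem' := by
    intro c u hu
    refine (MemLp.const_smul hu c).ae_eq ?_
    filter_upwards [Lp.coeFn_smul c u] with x hx
    rw [hx, Pi.smul_apply, Pi.smul_apply, smul_eq_mul, smul_eq_mul]
    ring

theorem mem_multiplicationDomain {d : ℕ} {Ω : Set (Space d)} {m : Space d → ℂ} {u : L2 Ω} :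
    u ∈ multiplicationDomain Ω m ↔ MemLp (fun x => m x * u x) 2 (volume.restrict Ω) :=
  Iff.rfl

/-- Multiplication by the function `m` as an operator in `L²(Ω)`, with its natural domain. -/
noncomputable def multiplication {d : ℕ} (Ω : Set (Space d)) (m : Space d → ℂ) :
    L2 Ω →ₗ.[ℂ] L2 Ω where
  domain := multiplicationDomain Ω m
  toFun :=
    { toFun := fun u => MemLp.toLp (fun x => m x * (u : L2 Ω) x) (mem_multiplicationDomain.mp u.2)
      map_add' := by
        rintro ⟨u, hu⟩ ⟨v, hv⟩
        refine Lp.ext ?_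
        refine (MemLp.coeFn_toLp _).trans (Filter.EventuallyEq.trans ?_ (Lp.coeFn_add _ _).symm)
        filter_upwards [Lp.coeFn_add u v, MemLp.coeFn_toLp (mem_multiplicationDomain.mp hu),
          MemLp.coeFn_toLp (mem_multiplicationDomain.mp hv)] with x hx h1 h2
        rw [Pi.add_apply, h1, h2, ← mul_add]
        exact congrArg (m x * ·) hx
      map_smul' := by
        rintro c ⟨u, hu⟩
        refine Lp.ext ?_
        refine (MemLp.coeFn_toLp _).trans (Filter.EventuallyEq.trans ?_ (Lp.coeFn_smul _ _).symm)
        filter_upwards [Lp.coeFn_smul c u,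
          MemLp.coeFn_toLp (mem_multiplicationDomain.mp hu)] with x hx h1
        rw [Pi.smul_apply, RingHom.id_apply, h1, smul_eq_mul, mul_left_comm]
        exact congrArg (m x * ·) hx }

/-- `A_q = A₀ + q`. (The domain of a sum of operators is the intersection of the domains.) -/
noncomputable def schrodingerOperator {d : ℕ} (Ω : Set (Space d))
    (a : Fin d → Fin d → Space d → ℝ) (q : Space d → ℝ) : L2 Ω →ₗ.[ℂ] L2 Ω :=
  dirichletOperator Ω a + multiplication Ω (fun x => (q x : ℂ))

/-- `A_q + ρ(x) p^{α(x)}`, with the principal branch of the power. -/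
noncomputable def pencil {d : ℕ} (Ω : Set (Space d)) (a : Fin d → Fin d → Space d → ℝ)
    (q ρ α : Space d → ℝ) (p : ℂ) : L2 Ω →ₗ.[ℂ] L2 Ω :=
  schrodingerOperator Ω a q + multiplication Ω (fun x => (ρ x : ℂ) * p ^ (α x : ℂ))

/-- `A_q + ρ(x) r^{α(x)} e^{iβα(x)}`. -/
noncomputable def polarPencil {d : ℕ} (Ω : Set (Space d)) (a : Fin d → Fin d → Space d → ℝ)
    (q ρ α : Space d → ℝ) (r β : ℝ) : L2 Ω →ₗ.[ℂ] L2 Ω :=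
  schrodingerOperator Ω a q + multiplication Ω
    (fun x => (ρ x : ℂ) * ((r ^ α x : ℝ) : ℂ) * Complex.exp (Complex.I * (β : ℂ) * (α x : ℂ)))

/-- The bounded operator `R`, defined on the whole Hilbert space, is the (two-sided) inverse of
the unbounded operator `T`. -/
def IsBoundedInverse {H : Type*} [NormedAddCommGroup H] [NormedSpace ℂ H]
    (T : H →ₗ.[ℂ] H) (R : H →L[ℂ] H) : Prop :=
  (∀ f : H, ∃ h : R f ∈ T.domain, T ⟨R f, h⟩ = f) ∧ ∀ u : T.domain, R (T u) = u

/-- `θ_*(r) = α_M⁻¹ min_{σ = ±1} arctan (ρ₀ / (3 ρ_M) · r^{σ (α_M - α₀)})`. -/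
noncomputable def thetaStar (α₀ αM ρ₀ ρM r : ℝ) : ℝ :=
  αM⁻¹ * min (Real.arctan (ρ₀ / (3 * ρM) * r ^ (αM - α₀)))
    (Real.arctan (ρ₀ / (3 * ρM) * r ^ (-(αM - α₀))))

/-- `c_*(β) = max_{j = 0, M} |sin (α_j β)|⁻¹`. -/
noncomputable def cStar (α₀ αM β : ℝ) : ℝ :=
  max |Real.sin (α₀ * β)|⁻¹ |Real.sin (αM * β)|⁻¹

open Classical in
/-- `C(r, β)` is `2 ρ₀⁻¹` if `|β| ≤ θ_*(r)` and `ρ₀⁻¹ c_*(β)` otherwise. -/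
noncomputable def resolventConst (α₀ αM ρ₀ ρM r β : ℝ) : ℝ :=
  if |β| ≤ thetaStar α₀ αM ρ₀ ρM r then 2 * ρ₀⁻¹ else ρ₀⁻¹ * cStar α₀ αM β

end VariableOrder

/-
The values of `ρ(x) p^α(x)` lie in the sector between the angles `0` and `αM arg p`, whose opening
is less than `π`. Rotating by half of that angle puts this sector into the closed right half-plane
and turns the positive half-line, where the form of `A_q` takes its values, by less than
`αM π / 2 < π / 2`. With the Poincaré inequality, the form of the pencil is therefore coercive
uniformly in `p`, and the pencil is invertible with a uniform bound. The explicit bound comes from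
a quarter rotation instead, or from none when `arg p` is small: this makes the real part of
`ρ(x) p^α(x)` at least a multiple of `ρ₀ |p|^α(x)`.

Since `p^α = exp (α log p)` is holomorphic in `p` as a bounded operator, so is the resolvent
`J T(p)⁻¹ J*`, where `J` embeds `H₀¹(Ω)` into `L²(Ω)` and `T(p)` represents the form on `H₀¹(Ω)`.
Multiplication by `q` is bounded from `H₀¹(Ω)` to `L²(Ω)` by the inequalities of Sobolev and Hölder,
so `D(A_q) = D(A₀)`; for `d = 2` Sobolev's inequality has to be used with an exponent below `2`.
-/

namespace VariableOrder

open scoped ComplexOrder InnerProductSpace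

section FormMethod

variable {V H : Type*} [NormedAddCommGroup V] [InnerProductSpace ℂ V] [CompleteSpace V]
  [NormedAddCommGroup H] [InnerProductSpace ℂ H] [CompleteSpace H]

/-- `P` is the operator in `H` associated through `J : V → H` with the form `(u, v) ↦ ⟪v, T u⟫`
on `V`: `P w = f` means that `w = J u` for some `u` with `⟪v, T u⟫ = ⟪J v, f⟫` for all `v`. The
last condition is encoded with the adjoint of `J`, the first equality through the graph of `P`. -/
def IsFormOperator (J : V →L[ℂ] H) (T : V →L[ℂ] V) (P : H →ₗ.[ℂ] H) : Prop :=
  ∀ w f, (w, f) ∈ P.graph ↔ ∃ u, J u = w ∧ T u = J.adjoint f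

/-- The inverse `J T⁻¹ J*` of the operator associated with `(J, T)`. When `T` is not invertible,
`T.inverse` is the junk value `0`. -/
noncomputable def formResolvent (J : V →L[ℂ] H) (T : V →L[ℂ] V) : H →L[ℂ] H :=
  J ∘L T.inverse ∘L J.adjoint

variable {J : V →L[ℂ] H} {S T : V →L[ℂ] V} {P N : H →ₗ.[ℂ] H} {l : ℂ} {b c k : ℝ}

theorem IsFormOperator.isBoundedInverse (hP : IsFormOperator J T P) (hT : T.IsInvertible) :
    IsBoundedInverse P (formResolvent J T) := by
  refine ⟨fun f => ?_, fun w => ?_⟩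
  · have hgraph : (formResolvent J T f, f) ∈ P.graph :=
      (hP _ _).2 ⟨_, rfl, hT.self_apply_inverse _⟩
    have hdom := LinearPMap.mem_domain_of_mem_graph hgraph
    exact ⟨hdom, ((LinearPMap.image_iff hdom).2 hgraph).symm⟩
  · obtain ⟨u, hu, hTu⟩ := (hP _ _).1 (P.mem_graph w)
    change J (T.inverse (J.adjoint (P w))) = w
    rw [← hTu, hT.inverse_apply_self, hu]

theorem IsFormOperator.add {B : V →L[ℂ] H} (hP : IsFormOperator J T P)
    (hN : ∀ u, (J u, B u) ∈ N.graph) : IsFormOperator J (T + J.adjoint ∘L B) (P + N) := by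
  intro w f
  constructor
  · intro hf
    obtain ⟨v, rfl, rfl⟩ := (P + N).mem_graph_iff.1 hf
    obtain ⟨u, hu, hTu⟩ := (hP _ _).1 (P.mem_graph ⟨v, v.2.1⟩)
    have hBu : B u = N ⟨v, v.2.2⟩ :=
      N.mem_graph_snd_inj (hN u) (N.mem_graph ⟨v, v.2.2⟩) hu
    refine ⟨u, hu, ?_⟩
    rw [LinearPMap.add_apply, map_add, ← hTu, ← hBu]
    rfl
  · rintro ⟨u, rfl, hu⟩
    have hTu : T u = J.adjoint (f - B u) := by
      rw [map_sub, ← hu]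
      simp
    have hPu : (J u, f - B u) ∈ P.graph := (hP _ _).2 ⟨u, rfl, hTu⟩
    have hwP := LinearPMap.mem_domain_of_mem_graph hPu
    have hwN := LinearPMap.mem_domain_of_mem_graph (hN u)
    refine (LinearPMap.image_iff (f := P + N) ⟨hwP, hwN⟩).1 ?_
    rw [LinearPMap.add_apply, ← (LinearPMap.image_iff hwP).2 hPu,
      ← (LinearPMap.image_iff hwN).2 (hN u), sub_add_cancel]

theorem IsFormOperator.domain_add {B : V →L[ℂ] H} (hP : IsFormOperator J T P)
    (hN : ∀ u, (J u, B u) ∈ N.graph) : (P + N).domain = P.domain := by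
  refine inf_eq_left.2 fun w hw => ?_
  obtain ⟨u, rfl, -⟩ := (hP _ _).1 (P.mem_graph ⟨w, hw⟩)
  exact LinearPMap.mem_domain_of_mem_graph (hN u)

theorem le_re_mul_inner_add_adjoint_comp {M : H →L[ℂ] H}
    (hS : ∀ u, ((c * ‖u‖ ^ 2 : ℝ) : ℂ) ≤ ⟪u, S u⟫_ℂ) (hl : 0 ≤ l.re)
    (hM : ∀ w, b * ‖w‖ ^ 2 ≤ (l * ⟪w, M w⟫_ℂ).re) (u : V) :
    l.re * c * ‖u‖ ^ 2 + b * ‖J u‖ ^ 2 ≤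
      (l * ⟪u, (S + J.adjoint ∘L (M ∘L J)) u⟫_ℂ).re := by
  have hinner : ⟪u, (S + J.adjoint ∘L (M ∘L J)) u⟫_ℂ = ⟪u, S u⟫_ℂ + ⟪J u, M (J u)⟫_ℂ := by
    simp [ContinuousLinearMap.adjoint_inner_right]
  obtain ⟨hre, him⟩ := Complex.le_def.1 (hS u)
  rw [Complex.ofReal_re] at hre
  rw [Complex.ofReal_im] at him
  rw [hinner, mul_add, Complex.add_re, Complex.mul_re l ⟪u, S u⟫_ℂ, ← him, mul_zero, sub_zero,
    mul_assoc]
  exact add_le_add (mul_le_mul_of_nonneg_left hre hl) (hM _)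

theorem isInvertible_of_le_re_mul_inner (hk : 0 < k)
    (hT : ∀ u, k * ‖u‖ ^ 2 ≤ (l * ⟪u, T u⟫_ℂ).re) : T.IsInvertible := by
  -- `‖l‖ + 1` instead of `‖l‖` because `l = 0` is possible when `V` is trivial.
  have hpos : 0 < k / (‖l‖ + 1) := by positivity
  have hunit : IsUnit T := by
    refine T.isUnit_of_forall_le_norm_inner_map (Real.toNNReal_pos.2 hpos) fun u => ?_
    rw [Real.coe_toNNReal _ hpos.le, norm_inner_symm, mul_div_assoc', div_le_iff₀ (by positivity)]
    calc ‖u‖ ^ 2 * k = k * ‖u‖ ^ 2 := mul_comm _ _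
      _ ≤ ‖l * ⟪u, T u⟫_ℂ‖ := (hT u).trans (Complex.re_le_norm _)
      _ = ‖⟪u, T u⟫_ℂ‖ * ‖l‖ := by rw [norm_mul, mul_comm]
      _ ≤ ‖⟪u, T u⟫_ℂ‖ * (‖l‖ + 1) := by gcongr; linarith
  obtain ⟨U, rfl⟩ := hunit
  exact ⟨ContinuousLinearEquiv.ofUnit U, rfl⟩

theorem norm_formResolvent_le (hT : T.IsInvertible) (hb : 0 < b)
    (hJ : ∀ u, b * ‖J u‖ ^ 2 ≤ (l * ⟪u, T u⟫_ℂ).re) : ‖formResolvent J T‖ ≤ ‖l‖ / b := by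
  refine ContinuousLinearMap.opNorm_le_bound _ (by positivity) fun f => ?_
  set u := T.inverse (J.adjoint f)
  change ‖J u‖ ≤ _
  have hquad : b * ‖J u‖ ^ 2 ≤ ‖l‖ * (‖J u‖ * ‖f‖) := calc
    b * ‖J u‖ ^ 2 ≤ (l * ⟪u, T u⟫_ℂ).re := hJ u
    _ = (l * ⟪J u, f⟫_ℂ).re := by
      rw [hT.self_apply_inverse, ContinuousLinearMap.adjoint_inner_right]
    _ ≤ ‖l‖ * ‖⟪J u, f⟫_ℂ‖ := (Complex.re_le_norm _).trans (norm_mul _ _).le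
    _ ≤ ‖l‖ * (‖J u‖ * ‖f‖) := by gcongr; exact norm_inner_le_norm _ _
  rw [div_mul_eq_mul_div, le_div_iff₀ hb]
  rcases (norm_nonneg (J u)).eq_or_lt with h0 | h0
  · rw [← h0, zero_mul]
    positivity
  · exact le_of_mul_le_mul_right (by linarith) h0

theorem differentiableAt_formResolvent {T : ℂ → V →L[ℂ] V} {p : ℂ} (hT : DifferentiableAt ℂ T p)
    (hp : (T p).IsInvertible) : DifferentiableAt ℂ (fun z => formResolvent J (T z)) p := by
  have hinv : DifferentiableAt ℂ (fun z => (T z).inverse) p :=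
    (hp.contDiffAt_map_inverse.differentiableAt one_ne_zero).comp p hT
  exact (differentiableAt_const J).clm_comp (hinv.clm_comp (differentiableAt_const _))

end FormMethod

section MultiplicationOperators

variable {X : Type*} [MeasurableSpace X] {μ : Measure X} {m : X → ℂ} {α ρ : X → ℝ}

/-- Multiplication by the essentially bounded function `m`, as a bounded operator in `Lᵖ`. -/
noncomputable def mulOperator {s : ℝ≥0∞} [Fact (1 ≤ s)] (hm : MemLp m ∞ μ) :
    Lp ℂ s μ →L[ℂ] Lp ℂ s μ :=
  (ContinuousLinearMap.mul ℂ ℂ).holderL μ ∞ s s (hm.toLp m)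

theorem coeFn_mulOperator {s : ℝ≥0∞} [Fact (1 ≤ s)] (hm : MemLp m ∞ μ) (w : Lp ℂ s μ) :
    mulOperator hm w =ᵐ[μ] fun x => m x * w x := by
  refine ((ContinuousLinearMap.mul ℂ ℂ).coeFn_holder (r := s) (hm.toLp m) w).trans ?_
  filter_upwards [hm.coeFn_toLp] with x hx
  rw [hx, ContinuousLinearMap.mul_apply']

theorem coeFn_mulOperator_pow {s : ℝ≥0∞} [Fact (1 ≤ s)] (hm : MemLp m ∞ μ) (w : Lp ℂ s μ) (n : ℕ) :
    (mulOperator hm ^ n) w =ᵐ[μ] fun x => m x ^ n * w x := by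
  induction n with
  | zero => simp
  | succ n ih =>
    rw [pow_succ']
    filter_upwards [coeFn_mulOperator hm ((mulOperator hm ^ n) w), ih] with x hx hn
    rw [mul_apply_eq_comp, hx, hn, pow_succ', mul_assoc]

theorem coeFn_exp_mulOperator {s : ℝ≥0∞} [Fact (1 ≤ s)] (hm : MemLp m ∞ μ) (w : Lp ℂ s μ) :
    NormedSpace.exp (mulOperator hm) w =ᵐ[μ] fun x => Complex.exp (m x) * w x := by
  set A : Lp ℂ s μ →L[ℂ] Lp ℂ s μ := mulOperator hm
  have hexp : HasSum (fun n : ℕ => ((n.factorial : ℂ)⁻¹ • A ^ n) w) (NormedSpace.exp A w) := by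
    have hA := NormedSpace.exp_series_hasSum_exp' (𝕂 := ℂ) A
    exact hA.mapL (ContinuousLinearMap.apply ℂ (Lp ℂ s μ) w)
  have hsummable : Summable fun n : ℕ => ‖((n.factorial : ℂ)⁻¹ • A ^ n) w‖ :=
    ((NormedSpace.norm_expSeries_summable' (𝕂 := ℂ) A).mul_right ‖w‖).of_nonneg_of_le
      (fun _ => norm_nonneg _) fun _ => ContinuousLinearMap.le_opNorm _ _
  have hterm : ∀ᵐ x ∂μ, ∀ n : ℕ,
      (((n.factorial : ℂ)⁻¹ • A ^ n) w) x = ((n.factorial : ℂ)⁻¹ • m x ^ n) * w x := by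
    refine ae_all_iff.2 fun n => ?_
    filter_upwards [Lp.coeFn_smul (n.factorial : ℂ)⁻¹ ((A ^ n) w), coeFn_mulOperator_pow hm w n]
      with x hsmul hpow
    rw [smul_apply, hsmul, Pi.smul_apply, hpow, smul_mul_assoc]
  filter_upwards [Lp.hasSum_coeFn_tsum (tsum_enorm_ne_top_iff_summable_norm.2 hsummable), hterm]
    with x hx hxn
  rw [hexp.tsum_eq] at hx
  simp only [hxn] at hx
  have hpointwise := (NormedSpace.exp_series_hasSum_exp' (𝕂 := ℂ) (m x)).mul_right (w x)
  rw [Complex.exp_eq_exp_ℂ]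
  exact hx.unique hpointwise

theorem mulOperator_const_mul {s : ℝ≥0∞} [Fact (1 ≤ s)] (hm : MemLp m ∞ μ) (z : ℂ) :
    mulOperator (s := s) (hm.const_mul z) = z • mulOperator hm :=
  map_smul ((ContinuousLinearMap.mul ℂ ℂ).holderL μ ∞ s s) z (hm.toLp m)

/-- Multiplication by `ρ p^α`, written as `ρ exp (α log p)` so that the dependence on `log p` is
that of a one-parameter group of bounded operators. -/
noncomputable def powMul {s : ℝ≥0∞} [Fact (1 ≤ s)] (hρ : MemLp ρ ∞ μ) (hα : MemLp α ∞ μ) (p : ℂ) :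
    Lp ℂ s μ →L[ℂ] Lp ℂ s μ :=
  mulOperator (m := fun x => (ρ x : ℂ)) hρ.ofReal ∘L
    NormedSpace.exp (Complex.log p • mulOperator (m := fun x => (α x : ℂ)) hα.ofReal)

theorem coeFn_powMul {s : ℝ≥0∞} [Fact (1 ≤ s)] (hρ : MemLp ρ ∞ μ) (hα : MemLp α ∞ μ) {p : ℂ}
    (hp : p ≠ 0) (w : Lp ℂ s μ) :
    powMul hρ hα p w =ᵐ[μ] fun x => (ρ x : ℂ) * p ^ (α x : ℂ) * w x := by
  rw [powMul, ← mulOperator_const_mul]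
  filter_upwards [coeFn_mulOperator (m := fun x => (ρ x : ℂ)) hρ.ofReal
      (NormedSpace.exp (mulOperator ((hα.ofReal (K := ℂ)).const_mul (Complex.log p))) w),
    coeFn_exp_mulOperator ((hα.ofReal (K := ℂ)).const_mul (Complex.log p)) w] with x hρx hexp
  rw [ContinuousLinearMap.comp_apply, hρx, hexp, Complex.cpow_def_of_ne_zero hp, mul_assoc]
  rfl

theorem differentiableAt_powMul {s : ℝ≥0∞} [Fact (1 ≤ s)] (hρ : MemLp ρ ∞ μ) (hα : MemLp α ∞ μ)
    {p : ℂ} (hp : p ∈ Complex.slitPlane) :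
    DifferentiableAt ℂ (powMul (s := s) hρ hα) p := by
  have hlog := (hasDerivAt_exp_smul_const (𝕂 := ℂ)
    (mulOperator (s := s) (m := fun x => (α x : ℂ)) hα.ofReal) (Complex.log p)).differentiableAt
  exact (differentiableAt_const _).clm_comp
    (hlog.fun_comp' p (Complex.differentiableAt_log hp))

theorem inner_nonneg_of_ae {v w : Lp ℂ 2 μ} (h : ∀ᵐ x ∂μ, 0 ≤ ⟪v x, w x⟫_ℂ) : 0 ≤ ⟪v, w⟫_ℂ := by
  rw [L2.inner_def]
  exact integral_nonneg_of_ae h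

theorem re_mul_inner_eq_integral (l : ℂ) (v w : Lp ℂ 2 μ) :
    (l * ⟪v, w⟫_ℂ).re = ∫ x, (l * ⟪v x, w x⟫_ℂ).re ∂μ := by
  rw [L2.inner_def, ← integral_const_mul]
  exact (integral_re ((L2.integrable_inner v w).const_mul l)).symm

theorem le_re_mul_inner_of_ae {u w : Lp ℂ 2 μ} (hu : u =ᵐ[μ] fun x => m x * w x) {l : ℂ} {b : ℝ}
    (hb : ∀ᵐ x ∂μ, b ≤ (l * m x).re) : b * ‖w‖ ^ 2 ≤ (l * ⟪w, u⟫_ℂ).re := by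
  have hnorm : b * ‖w‖ ^ 2 = ((b : ℂ) * ⟪w, w⟫_ℂ).re := by
    rw [Complex.re_ofReal_mul]
    exact congrArg (b * ·) (inner_self_eq_norm_sq (𝕜 := ℂ) w).symm
  rw [hnorm, re_mul_inner_eq_integral, re_mul_inner_eq_integral]
  refine integral_mono_ae ((L2.integrable_inner w w).const_mul (b : ℂ)).re
    ((L2.integrable_inner w u).const_mul l).re ?_
  filter_upwards [hu, hb] with x hux hbx
  have hsq : l * ⟪w x, u x⟫_ℂ = (l * m x) * ((‖w x‖ ^ 2 : ℝ) : ℂ) := by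
    rw [hux, RCLike.inner_apply, mul_assoc (m x), Complex.mul_conj, Complex.normSq_eq_norm_sq]
    ring
  have hsq' : ⟪w x, w x⟫_ℂ = ((‖w x‖ ^ 2 : ℝ) : ℂ) := by
    rw [inner_self_eq_norm_sq_to_K, Complex.ofReal_pow]
    rfl
  rw [hsq, hsq', Complex.re_mul_ofReal, Complex.re_mul_ofReal, Complex.ofReal_re]
  exact mul_le_mul_of_nonneg_right hbx (by positivity)

end MultiplicationOperators

section Angles

variable {α α₀ αM ρ₀ ρM r β : ℝ}

theorem inv_max_rpow_neg_le (hr : 0 < r) (h0 : α₀ ≤ α) (hM : α ≤ αM) :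
    (max (r ^ (-α₀)) (r ^ (-αM)))⁻¹ ≤ r ^ α := by
  rw [inv_le_comm₀ (lt_max_of_lt_left (Real.rpow_pos_of_pos hr _)) (Real.rpow_pos_of_pos hr _),
    ← Real.rpow_neg hr.le]
  rcases le_total 1 r with h | h
  · exact (Real.rpow_le_rpow_of_exponent_le h (neg_le_neg h0)).trans (le_max_left _ _)
  · exact (Real.rpow_le_rpow_of_exponent_ge hr h (neg_le_neg hM)).trans (le_max_right _ _)

theorem thetaStar_nonneg (hαM : 0 ≤ αM) (hρ₀ : 0 ≤ ρ₀) (hρM : 0 ≤ ρM) (hr : 0 ≤ r) :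
    0 ≤ thetaStar α₀ αM ρ₀ ρM r :=
  mul_nonneg (inv_nonneg.2 hαM)
    (le_min (Real.arctan_nonneg.2 (by positivity)) (Real.arctan_nonneg.2 (by positivity)))

theorem mul_thetaStar_le_pi_div_four (hα : α₀ ≤ αM) (hαM : 0 < αM) (hρ : ρ₀ ≤ ρM) (hρM : 0 < ρM)
    (hr : 0 < r) : αM * thetaStar α₀ αM ρ₀ ρM r ≤ Real.pi / 4 := by
  have harctan {t : ℝ} (ht0 : 0 ≤ t) (ht1 : t ≤ 1) :
      Real.arctan (ρ₀ / (3 * ρM) * t) ≤ Real.pi / 4 := by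
    rw [← Real.arctan_one]
    refine Real.arctan_strictMono.monotone (mul_le_one₀ ?_ ht0 ht1)
    rw [div_le_one (by positivity)]
    linarith
  rw [thetaStar, mul_inv_cancel_left₀ hαM.ne']
  rcases le_total 1 r with h | h
  · exact min_le_of_right_le <| harctan (Real.rpow_nonneg hr.le _)
      (Real.rpow_le_one_of_one_le_of_nonpos h (by linarith))
  · exact min_le_of_left_le <| harctan (Real.rpow_nonneg hr.le _)
      (Real.rpow_le_one hr.le h (by linarith))

theorem half_le_cos_mul (h0 : 0 ≤ α) (hM : α ≤ αM) (hβ : αM * |β| ≤ Real.pi / 4) :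
    1 / 2 ≤ Real.cos (α * β) := by
  have habs : |α * β| ≤ Real.pi / 3 := calc
    |α * β| = α * |β| := by rw [abs_mul, abs_of_nonneg h0]
    _ ≤ αM * |β| := by gcongr
    _ ≤ Real.pi / 3 := by linarith [Real.pi_pos]
  rw [← Real.cos_pi_div_three, ← Real.cos_abs (α * β)]
  exact Real.cos_le_cos_of_nonneg_of_le_pi (abs_nonneg _) (by linarith [Real.pi_pos]) habs

theorem sin_mul_abs_pos (h0 : 0 < α) (h1 : α < 1) (hβ0 : β ≠ 0) (hβ : |β| < Real.pi) :
    0 < Real.sin (α * |β|) := by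
  have hβpos : 0 < |β| := abs_pos.2 hβ0
  exact Real.sin_pos_of_pos_of_lt_pi (by positivity) (by nlinarith)

theorem abs_sin_mul (h0 : 0 < α) (h1 : α < 1) (hβ0 : β ≠ 0) (hβ : |β| < Real.pi) :
    |Real.sin (α * β)| = Real.sin (α * |β|) := by
  rw [← abs_of_pos (sin_mul_abs_pos h0 h1 hβ0 hβ)]
  rcases abs_choice β with h | h <;> rw [h]
  rw [mul_neg, Real.sin_neg, abs_neg]

theorem cStar_pos (hα₀ : 0 < α₀) (hα₁ : α₀ < 1) (hβ0 : β ≠ 0) (hβ : |β| < Real.pi) :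
    0 < cStar α₀ αM β := by
  refine lt_max_of_lt_left (inv_pos.2 ?_)
  rw [abs_sin_mul hα₀ hα₁ hβ0 hβ]
  exact sin_mul_abs_pos hα₀ hα₁ hβ0 hβ

theorem inv_cStar_le_sin (hα₀ : 0 < α₀) (h0 : α₀ ≤ α) (hM : α ≤ αM) (hαM : αM < 1)
    (hβ0 : β ≠ 0) (hβ : |β| < Real.pi) : (cStar α₀ αM β)⁻¹ ≤ Real.sin (α * |β|) := by
  have hM0 : 0 < αM := hα₀.trans_le (h0.trans hM)
  have hα₁ : α₀ < 1 := (h0.trans hM).trans_lt hαM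
  have hconcave : min (Real.sin (α₀ * |β|)) (Real.sin (αM * |β|)) ≤ Real.sin (α * |β|) :=
    strictConcaveOn_sin_Icc.concaveOn.min_le_of_mem_Icc
      ⟨by positivity, by nlinarith [abs_nonneg β]⟩ ⟨by positivity, by nlinarith [abs_nonneg β]⟩
      ⟨by gcongr, by gcongr⟩
  refine le_trans (le_min ?_ ?_) hconcave
  · rw [inv_le_comm₀ (cStar_pos hα₀ hα₁ hβ0 hβ) (sin_mul_abs_pos hα₀ hα₁ hβ0 hβ),
      ← abs_sin_mul hα₀ hα₁ hβ0 hβ]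
    exact le_max_left _ _
  · rw [inv_le_comm₀ (cStar_pos hα₀ hα₁ hβ0 hβ) (sin_mul_abs_pos hM0 hαM hβ0 hβ),
      ← abs_sin_mul hM0 hαM hβ0 hβ]
    exact le_max_right _ _

theorem cos_mul_sub_half_nonneg (h0 : 0 ≤ α) (hM : α ≤ αM) (hαM : αM ≤ 1)
    (hβ : |β| ≤ Real.pi) : 0 ≤ Real.cos (α * β - αM * β / 2) := by
  have hdiff : |α - αM / 2| ≤ 1 / 2 := abs_le.2 ⟨by linarith, by linarith⟩
  have habs : |α * β - αM * β / 2| ≤ Real.pi / 2 := calc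
    |α * β - αM * β / 2| = |α - αM / 2| * |β| := by rw [← abs_mul]; ring_nf
    _ ≤ 1 / 2 * Real.pi := mul_le_mul hdiff hβ (abs_nonneg β) (by norm_num)
    _ = Real.pi / 2 := by ring
  exact Real.cos_nonneg_of_neg_pi_div_two_le_of_le (abs_le.1 habs).1 (abs_le.1 habs).2

theorem cos_mul_pi_div_two_le (h0 : 0 ≤ α) (h1 : α ≤ 1) (hβ : |β| ≤ Real.pi) :
    Real.cos (α * Real.pi / 2) ≤ Real.cos (α * β / 2) := by
  rw [← Real.cos_abs (α * β / 2), abs_div, abs_mul, abs_of_nonneg h0, abs_two]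
  exact Real.cos_le_cos_of_nonneg_of_le_pi (by positivity) (by nlinarith [Real.pi_pos])
    (by gcongr)

theorem cos_mul_pi_div_two_pos (h0 : 0 ≤ α) (h1 : α < 1) : 0 < Real.cos (α * Real.pi / 2) :=
  Real.cos_pos_of_mem_Ioo ⟨by nlinarith [Real.pi_pos], by nlinarith [Real.pi_pos]⟩

theorem abs_arg_lt_pi {p : ℂ} (hp : p ∈ Complex.slitPlane) : |p.arg| < Real.pi :=
  abs_lt.2 ⟨p.neg_pi_lt_arg, p.arg_le_pi.lt_of_ne (Complex.slitPlane_arg_ne_pi hp)⟩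

theorem re_exp_mul_I_mul_cpow (φ t s : ℝ) (p : ℂ) :
    (Complex.exp (φ * Complex.I) * (t * p ^ (s : ℂ))).re =
      t * ‖p‖ ^ s * Real.cos (s * p.arg + φ) := by
  rw [mul_left_comm, Complex.re_ofReal_mul, Complex.mul_re, Complex.exp_ofReal_mul_I_re,
    Complex.exp_ofReal_mul_I_im, Complex.cpow_ofReal_re, Complex.cpow_ofReal_im, Real.cos_add,
    mul_comm s]
  ring

end Angles

section ResolventBounds

variable {X V : Type*} [MeasurableSpace X] {μ : Measure X} [NormedAddCommGroup V]
  [InnerProductSpace ℂ V] [CompleteSpace V] {J : V →L[ℂ] Lp ℂ 2 μ} {S : V →L[ℂ] V} {b c φ : ℝ}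
  {α ρ : X → ℝ} {α₀ αM ρ₀ ρM : ℝ} {p : ℂ}

/-- The operator in the form domain representing the form of `S` perturbed by `ρ p^α`. -/
noncomputable def pencilForm (J : V →L[ℂ] Lp ℂ 2 μ) (S : V →L[ℂ] V) (hρ : MemLp ρ ∞ μ)
    (hα : MemLp α ∞ μ) (p : ℂ) : V →L[ℂ] V :=
  S + J.adjoint ∘L (powMul hρ hα p ∘L J)

theorem le_re_exp_mul_inner_pencilForm (hρ : MemLp ρ ∞ μ) (hα : MemLp α ∞ μ)
    (hS : ∀ u, ((c * ‖u‖ ^ 2 : ℝ) : ℂ) ≤ ⟪u, S u⟫_ℂ) (hp : p ≠ 0) (hφ : 0 ≤ Real.cos φ)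
    (hb : ∀ᵐ x ∂μ, b ≤ ρ x * ‖p‖ ^ α x * Real.cos (α x * p.arg + φ)) (u : V) :
    Real.cos φ * c * ‖u‖ ^ 2 + b * ‖J u‖ ^ 2 ≤
      (Complex.exp (φ * Complex.I) * ⟪u, pencilForm J S hρ hα p u⟫_ℂ).re := by
  rw [← Complex.exp_ofReal_mul_I_re] at hφ ⊢
  refine le_re_mul_inner_add_adjoint_comp hS hφ (fun w => ?_) u
  refine le_re_mul_inner_of_ae (coeFn_powMul hρ hα hp w) (hb.mono fun x hx => ?_)
  rwa [re_exp_mul_I_mul_cpow]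

-- The rotation by `-αM arg p / 2` moves the sector spanned by the values of `ρ p^α` into the
-- right half-plane and keeps a definite fraction of the coercivity of `S`.
theorem coercive_pencilForm (hρ : MemLp ρ ∞ μ) (hα : MemLp α ∞ μ) (hc : 0 ≤ c)
    (hS : ∀ u, ((c * ‖u‖ ^ 2 : ℝ) : ℂ) ≤ ⟪u, S u⟫_ℂ) (hα_bound : ∀ᵐ x ∂μ, 0 ≤ α x ∧ α x ≤ αM)
    (hαM0 : 0 ≤ αM) (hαM1 : αM < 1) (hρ_nonneg : ∀ᵐ x ∂μ, 0 ≤ ρ x) (hp : p ≠ 0) (u : V) :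
    Real.cos (αM * Real.pi / 2) * c * ‖u‖ ^ 2 ≤
      (Complex.exp ((-(αM * p.arg / 2) : ℝ) * Complex.I) *
        ⟪u, pencilForm J S hρ hα p u⟫_ℂ).re := by
  have hcos := cos_mul_pi_div_two_le hαM0 hαM1.le p.abs_arg_le_pi
  have hφ : 0 ≤ Real.cos (-(αM * p.arg / 2)) := by
    rw [Real.cos_neg]
    exact (cos_mul_pi_div_two_pos hαM0 hαM1).le.trans hcos
  have hsymbol : ∀ᵐ x ∂μ, 0 ≤ ρ x * ‖p‖ ^ α x * Real.cos (α x * p.arg + -(αM * p.arg / 2)) := by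
    filter_upwards [hα_bound, hρ_nonneg] with x hαx hρx
    rw [← sub_eq_add_neg]
    have := cos_mul_sub_half_nonneg hαx.1 hαx.2 hαM1.le p.abs_arg_le_pi
    positivity
  have hrange := le_re_exp_mul_inner_pencilForm (J := J) hρ hα hS hp hφ hsymbol u
  rw [zero_mul, add_zero, Real.cos_neg] at hrange
  exact le_trans (by gcongr) hrange

theorem isInvertible_pencilForm (hρ : MemLp ρ ∞ μ) (hα : MemLp α ∞ μ) (hc : 0 < c)
    (hS : ∀ u, ((c * ‖u‖ ^ 2 : ℝ) : ℂ) ≤ ⟪u, S u⟫_ℂ) (hα_bound : ∀ᵐ x ∂μ, 0 ≤ α x ∧ α x ≤ αM)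
    (hαM0 : 0 ≤ αM) (hαM1 : αM < 1) (hρ_nonneg : ∀ᵐ x ∂μ, 0 ≤ ρ x) (hp : p ≠ 0) :
    (pencilForm J S hρ hα p).IsInvertible :=
  isInvertible_of_le_re_mul_inner (mul_pos (cos_mul_pi_div_two_pos hαM0 hαM1) hc)
    (coercive_pencilForm hρ hα hc.le hS hα_bound hαM0 hαM1 hρ_nonneg hp)

theorem norm_formResolvent_pencilForm_le (hρ : MemLp ρ ∞ μ) (hα : MemLp α ∞ μ) (hc : 0 < c)
    (hS : ∀ u, ((c * ‖u‖ ^ 2 : ℝ) : ℂ) ≤ ⟪u, S u⟫_ℂ) (hα_bound : ∀ᵐ x ∂μ, 0 ≤ α x ∧ α x ≤ αM)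
    (hαM0 : 0 ≤ αM) (hαM1 : αM < 1) (hρ_nonneg : ∀ᵐ x ∂μ, 0 ≤ ρ x) (hJ : ∀ u, ‖J u‖ ≤ ‖u‖)
    (hp : p ≠ 0) :
    ‖formResolvent J (pencilForm J S hρ hα p)‖ ≤ 1 / (Real.cos (αM * Real.pi / 2) * c) := by
  have hb := mul_pos (cos_mul_pi_div_two_pos hαM0 hαM1) hc
  rw [← Complex.norm_exp_ofReal_mul_I (-(αM * p.arg / 2))]
  refine norm_formResolvent_le
    (isInvertible_pencilForm hρ hα hc hS hα_bound hαM0 hαM1 hρ_nonneg hp) hb fun u => ?_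
  refine le_trans ?_ (coercive_pencilForm hρ hα hc.le hS hα_bound hαM0 hαM1 hρ_nonneg hp u)
  gcongr
  exact hJ u

theorem norm_formResolvent_pencilForm_le_of_le_cos {s : ℝ} (hρ : MemLp ρ ∞ μ) (hα : MemLp α ∞ μ)
    (hc : 0 ≤ c) (hS : ∀ u, ((c * ‖u‖ ^ 2 : ℝ) : ℂ) ≤ ⟪u, S u⟫_ℂ) (hρ₀ : 0 < ρ₀)
    (hα_bound : ∀ᵐ x ∂μ, α₀ ≤ α x ∧ α x ≤ αM) (hρ_bound : ∀ᵐ x ∂μ, ρ₀ ≤ ρ x) (hp : p ≠ 0)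
    (hT : (pencilForm J S hρ hα p).IsInvertible) (hφ : 0 ≤ Real.cos φ) (hs : 0 < s)
    (hcos : ∀ᵐ x ∂μ, s⁻¹ ≤ Real.cos (α x * p.arg + φ)) :
    ‖formResolvent J (pencilForm J S hρ hα p)‖ ≤
      ρ₀⁻¹ * s * max (‖p‖ ^ (-α₀)) (‖p‖ ^ (-αM)) := by
  set m := max (‖p‖ ^ (-α₀)) (‖p‖ ^ (-αM))
  have hm : 0 < m := lt_max_of_lt_left (Real.rpow_pos_of_pos (norm_pos_iff.2 hp) _)
  have hsymbol : ∀ᵐ x ∂μ, ρ₀ * m⁻¹ * s⁻¹ ≤ ρ x * ‖p‖ ^ α x * Real.cos (α x * p.arg + φ) := by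
    filter_upwards [hα_bound, hρ_bound, hcos] with x hαx hρx hx
    have hpow : m⁻¹ ≤ ‖p‖ ^ α x := inv_max_rpow_neg_le (norm_pos_iff.2 hp) hαx.1 hαx.2
    have : 0 ≤ ρ x := hρ₀.le.trans hρx
    gcongr
  have hnorm := norm_formResolvent_le hT (b := ρ₀ * m⁻¹ * s⁻¹) (by positivity) fun u => by
    refine le_trans ?_ (le_re_exp_mul_inner_pencilForm (J := J) hρ hα hS hp hφ hsymbol u)
    exact le_add_of_nonneg_left (by positivity)
  rw [Complex.norm_exp_ofReal_mul_I] at hnorm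
  exact hnorm.trans_eq (by field_simp)

theorem norm_formResolvent_pencilForm_le_cStar (hρ : MemLp ρ ∞ μ) (hα : MemLp α ∞ μ)
    (hc : 0 ≤ c) (hS : ∀ u, ((c * ‖u‖ ^ 2 : ℝ) : ℂ) ≤ ⟪u, S u⟫_ℂ) (hα₀ : 0 < α₀)
    (hα_le : α₀ ≤ αM) (hαM : αM < 1) (hρ₀ : 0 < ρ₀)
    (hα_bound : ∀ᵐ x ∂μ, α₀ ≤ α x ∧ α x ≤ αM) (hρ_bound : ∀ᵐ x ∂μ, ρ₀ ≤ ρ x) (hp : p ≠ 0)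
    (hT : (pencilForm J S hρ hα p).IsInvertible) (harg0 : p.arg ≠ 0)
    (harg : |p.arg| < Real.pi) :
    ‖formResolvent J (pencilForm J S hρ hα p)‖ ≤
      ρ₀⁻¹ * cStar α₀ αM p.arg * max (‖p‖ ^ (-α₀)) (‖p‖ ^ (-αM)) := by
  have hs := cStar_pos (αM := αM) hα₀ (hα_le.trans_lt hαM) harg0 harg
  have hsin : ∀ᵐ x ∂μ, (cStar α₀ αM p.arg)⁻¹ ≤ Real.sin (α x * |p.arg|) :=
    hα_bound.mono fun x hx => inv_cStar_le_sin hα₀ hx.1 hx.2 hαM harg0 harg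
  rcases lt_or_gt_of_ne harg0 with hneg | hpos
  · refine norm_formResolvent_pencilForm_le_of_le_cos (φ := Real.pi / 2) hρ hα hc hS hρ₀
      hα_bound hρ_bound hp hT Real.cos_pi_div_two.ge hs (hsin.mono fun x hx => ?_)
    rwa [Real.cos_add_pi_div_two, ← Real.sin_neg, ← mul_neg, ← abs_of_neg hneg]
  · refine norm_formResolvent_pencilForm_le_of_le_cos (φ := -(Real.pi / 2)) hρ hα hc hS hρ₀
      hα_bound hρ_bound hp hT (by rw [Real.cos_neg, Real.cos_pi_div_two]) hs
      (hsin.mono fun x hx => ?_)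
    rw [abs_of_pos hpos] at hx
    rwa [← sub_eq_add_neg, Real.cos_sub_pi_div_two]

theorem norm_formResolvent_pencilForm_le_resolventConst (hρ : MemLp ρ ∞ μ) (hα : MemLp α ∞ μ)
    (hc : 0 ≤ c) (hS : ∀ u, ((c * ‖u‖ ^ 2 : ℝ) : ℂ) ≤ ⟪u, S u⟫_ℂ) (hα₀ : 0 < α₀)
    (hα_le : α₀ ≤ αM) (hαM : αM < 1) (hρ₀ : 0 < ρ₀) (hρ_le : ρ₀ ≤ ρM)
    (hα_bound : ∀ᵐ x ∂μ, α₀ ≤ α x ∧ α x ≤ αM) (hρ_bound : ∀ᵐ x ∂μ, ρ₀ ≤ ρ x)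
    (hp : p ∈ Complex.slitPlane) (hT : (pencilForm J S hρ hα p).IsInvertible) :
    ‖formResolvent J (pencilForm J S hρ hα p)‖ ≤
      resolventConst α₀ αM ρ₀ ρM ‖p‖ p.arg * max (‖p‖ ^ (-α₀)) (‖p‖ ^ (-αM)) := by
  have hp0 := Complex.slitPlane_ne_zero hp
  have hαM0 : 0 < αM := hα₀.trans_le hα_le
  have hρM0 : 0 < ρM := hρ₀.trans_le hρ_le
  rw [resolventConst]
  split_ifs with hθ
  · have hsmall : αM * |p.arg| ≤ Real.pi / 4 :=
      (mul_le_mul_of_nonneg_left hθ hαM0.le).trans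
        (mul_thetaStar_le_pi_div_four hα_le hαM0 hρ_le hρM0 (norm_pos_iff.2 hp0))
    rw [mul_comm 2]
    refine norm_formResolvent_pencilForm_le_of_le_cos (φ := 0) hρ hα hc hS hρ₀ hα_bound
      hρ_bound hp0 hT (by rw [Real.cos_zero]; exact zero_le_one) two_pos
      (hα_bound.mono fun x hx => ?_)
    rw [add_zero, ← one_div]
    exact half_le_cos_mul (hα₀.le.trans hx.1) hx.2 hsmall
  · have harg0 : p.arg ≠ 0 := by
      intro h0
      rw [h0, abs_zero] at hθ
      exact hθ (thetaStar_nonneg hαM0.le hρ₀.le hρM0.le (norm_nonneg p))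
    exact norm_formResolvent_pencilForm_le_cStar hρ hα hc hS hα₀ hα_le hαM hρ₀ hα_bound
      hρ_bound hp0 hT harg0 (abs_arg_lt_pi hp)

theorem differentiableAt_formResolvent_pencilForm (hρ : MemLp ρ ∞ μ) (hα : MemLp α ∞ μ)
    (hp : p ∈ Complex.slitPlane) (hT : (pencilForm J S hρ hα p).IsInvertible) :
    DifferentiableAt ℂ (fun z => formResolvent J (pencilForm J S hρ hα z)) p := by
  refine differentiableAt_formResolvent ?_ hT
  exact (differentiableAt_const S).add ((differentiableAt_const _).clm_comp
    ((differentiableAt_powMul hρ hα hp).clm_comp (differentiableAt_const J)))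

end ResolventBounds

section Sobolev

open scoped NNReal

variable {d : ℕ} {Ω : Set (Space d)}

theorem norm_fderiv_le_sum_partialDeriv (φ : Space d → ℂ) (x : Space d) :
    ‖fderiv ℝ φ x‖ ≤ ∑ i, ‖partialDeriv i φ x‖ := by
  refine ContinuousLinearMap.opNorm_le_bound _ (Finset.sum_nonneg fun _ _ => norm_nonneg _)
    fun v => ?_
  have hv : v = ∑ i, v i • EuclideanSpace.single i (1 : ℝ) := by
    ext j
    simp [Finset.sum_apply, Pi.single_apply]
  conv_lhs => rw [hv, map_sum]
  rw [Finset.sum_mul]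
  refine (norm_sum_le _ _).trans (Finset.sum_le_sum fun i _ => ?_)
  rw [map_smul, norm_smul, mul_comm]
  exact mul_le_mul_of_nonneg_left (PiLp.norm_apply_le v i) (norm_nonneg _)

theorem eLpNorm_fderiv_le_sum {φ : Space d → ℂ} (hφ : IsTestFunction Ω φ) {p : ℝ≥0∞}
    (hp : 1 ≤ p) (μ : Measure (Space d)) :
    eLpNorm (fderiv ℝ φ) p μ ≤ ∑ i, eLpNorm (partialDeriv i φ) p μ := calc
  eLpNorm (fderiv ℝ φ) p μ ≤ eLpNorm (∑ i, fun x => ‖partialDeriv i φ x‖) p μ :=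
    eLpNorm_mono_real fun x => by
      simpa only [Finset.sum_apply] using norm_fderiv_le_sum_partialDeriv φ x
  _ ≤ ∑ i, eLpNorm (fun x => ‖partialDeriv i φ x‖) p μ :=
    eLpNorm_sum_le (fun i _ => (hφ.continuous_partialDeriv i).norm.aestronglyMeasurable) hp
  _ = ∑ i, eLpNorm (partialDeriv i φ) p μ := Finset.sum_congr rfl fun i _ => eLpNorm_norm _

theorem IsTestFunction.exists_eLpNorm_le (hd : 0 < d) (hΩ : volume Ω ≠ ⊤) {p s : ℝ≥0}
    (hp1 : 1 ≤ p) (hp2 : p ≤ 2) (hps : s⁻¹ = (p⁻¹ - (d : ℝ)⁻¹ : ℝ)) :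
    ∃ C : ℝ≥0, ∀ φ : Space d → ℂ, IsTestFunction Ω φ →
      eLpNorm φ s (volume.restrict Ω) ≤
        C * ∑ i, eLpNorm (partialDeriv i φ) 2 (volume.restrict Ω) := by
  set G : ℝ≥0 := SNormLESNormFDerivOfEqConst ℂ (volume : Measure (Space d)) p
  set e : ℝ := 1 / (p : ℝ≥0∞).toReal - 1 / (2 : ℝ≥0∞).toReal
  have he : 0 ≤ e := by
    simp only [e, ENNReal.coe_toReal, ENNReal.toReal_ofNat, sub_nonneg]
    exact one_div_le_one_div_of_le (by positivity) (by exact_mod_cast hp2)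
  refine ⟨G * (volume Ω ^ e).toNNReal, fun φ hφ => ?_⟩
  have hsobolev : eLpNorm φ s volume ≤ G * eLpNorm (fderiv ℝ φ) p volume := by
    refine eLpNorm_le_eLpNorm_fderiv_of_eq volume (hφ.smooth.of_le (by simp)) hφ.compact hp1 ?_ ?_
    · rwa [finrank_euclideanSpace_fin]
    · rw [finrank_euclideanSpace_fin, ← hps, NNReal.coe_inv]
  have hfderiv : eLpNorm (fderiv ℝ φ) p volume ≤
      eLpNorm (fderiv ℝ φ) 2 (volume.restrict Ω) * volume Ω ^ e := by
    rw [← eLpNorm_restrict_eq_of_support_subset (μ := volume) (f := fderiv ℝ φ)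
      ((support_fderiv_subset ℝ).trans hφ.support_subset), ← Measure.restrict_apply_univ Ω]
    exact eLpNorm_le_eLpNorm_mul_rpow_measure_univ (by exact_mod_cast hp2)
      (hφ.smooth.continuous_fderiv (by simp)).aestronglyMeasurable
  rw [ENNReal.coe_mul, ENNReal.coe_toNNReal (ENNReal.rpow_ne_top_of_nonneg he hΩ), mul_assoc,
    mul_comm (volume Ω ^ e)]
  calc eLpNorm φ s (volume.restrict Ω) ≤ eLpNorm φ s volume :=
        eLpNorm_mono_measure _ Measure.restrict_le_self
    _ ≤ G * (eLpNorm (fderiv ℝ φ) 2 (volume.restrict Ω) * volume Ω ^ e) := by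
        refine hsobolev.trans ?_
        gcongr
    _ ≤ _ := by
        gcongr
        exact eLpNorm_fderiv_le_sum hφ one_le_two _

theorem eLpNorm_fst_le_of_mem_sobolevH10 {s : ℝ≥0∞} {C : ℝ≥0}
    (hC : ∀ φ : Space d → ℂ, IsTestFunction Ω φ → eLpNorm φ s (volume.restrict Ω) ≤
      C * ∑ i, eLpNorm (partialDeriv i φ) 2 (volume.restrict Ω))
    {w : L2 Ω × (Fin d → L2 Ω)} (hw : w ∈ sobolevH10 Ω) :
    eLpNorm w.1 s (volume.restrict Ω) ≤ C * ∑ i, ‖w.2 i‖ₑ := by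
  obtain ⟨v, hv, hlim⟩ := mem_closure_iff_seq_limit.1 hw.2
  have hfst : Filter.Tendsto (fun n => (v n).1) Filter.atTop (nhds w.1) :=
    (continuous_fst.tendsto w).comp hlim
  have hsnd : Filter.Tendsto (fun n => C * ∑ i, ‖(v n).2 i‖ₑ) Filter.atTop
      (nhds (C * ∑ i, ‖w.2 i‖ₑ)) := by
    refine ENNReal.Tendsto.const_mul (tendsto_finsetSum _ fun i _ => ?_)
      (Or.inr ENNReal.coe_ne_top)
    exact ((continuous_enorm.comp ((continuous_apply i).comp continuous_snd)).tendsto w).comp hlim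
  have hbound : ∀ n, eLpNorm (v n).1 s (volume.restrict Ω) ≤ C * ∑ i, ‖(v n).2 i‖ₑ := by
    intro n
    obtain ⟨φ, hφ, hφ1, hφ2⟩ := hv n
    simp only [Lp.enorm_def]
    rw [eLpNorm_congr_ae hφ1, Finset.sum_congr rfl fun i _ => eLpNorm_congr_ae (hφ2 i)]
    exact hC φ hφ
  obtain ⟨ns, hns, hae⟩ := (tendstoInMeasure_of_tendsto_Lp hfst).exists_seq_tendsto_ae
  calc eLpNorm w.1 s (volume.restrict Ω)
      ≤ Filter.atTop.liminf fun n => eLpNorm (v (ns n)).1 s (volume.restrict Ω) :=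
        Lp.eLpNorm_lim_le_liminf_eLpNorm (fun n => Lp.aestronglyMeasurable _) _ hae
    _ ≤ Filter.atTop.liminf fun n => C * ∑ i, ‖(v (ns n)).2 i‖ₑ :=
        Filter.liminf_le_liminf (Filter.Eventually.of_forall fun n => hbound (ns n))
    _ = C * ∑ i, ‖w.2 i‖ₑ := (hsnd.comp hns.tendsto_atTop).liminf_eq

theorem exists_sobolev_exponents (hd : 2 ≤ d) {κ : ℝ≥0∞} (hκ2 : 2 < κ) (hκ : (d : ℝ≥0∞) ≤ κ) :
    ∃ p s : ℝ≥0, 1 ≤ p ∧ p ≤ 2 ∧ s⁻¹ = (p⁻¹ - (d : ℝ)⁻¹ : ℝ) ∧ ENNReal.HolderTriple κ s 2 := by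
  obtain ⟨k, hk⟩ : ∃ k : ℝ≥0, (k : ℝ≥0∞) = κ⁻¹ :=
    ⟨_, ENNReal.coe_toNNReal (ENNReal.inv_ne_top.2 (hκ2.trans_le' bot_le).ne')⟩
  have hd0 : (d : ℝ≥0) ≠ 0 := by positivity
  have hk2 : k < 2⁻¹ := by
    rw [← ENNReal.coe_lt_coe, hk, ENNReal.coe_inv two_ne_zero]
    exact ENNReal.inv_lt_inv.2 hκ2
  have hkd : k ≤ (d : ℝ≥0)⁻¹ := by
    rw [← ENNReal.coe_le_coe, hk, ENNReal.coe_inv hd0]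
    exact ENNReal.inv_le_inv.2 hκ
  have hd2 : (d : ℝ≥0)⁻¹ ≤ 2⁻¹ := inv_anti₀ two_pos (by exact_mod_cast hd)
  have hsk : k + (2⁻¹ - k) = 2⁻¹ := add_tsub_cancel_of_le hk2.le
  have hs0 : 0 < 2⁻¹ - k := tsub_pos_of_lt hk2
  refine ⟨(2⁻¹ - k + (d : ℝ≥0)⁻¹)⁻¹, (2⁻¹ - k)⁻¹, ?_, ?_, ?_, ⟨?_⟩⟩
  · refine (one_le_inv₀ (by positivity)).2 ?_
    calc 2⁻¹ - k + (d : ℝ≥0)⁻¹ ≤ 2⁻¹ + 2⁻¹ := add_le_add tsub_le_self hd2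
      _ = 1 := by norm_num
  · refine inv_le_of_inv_le₀ two_pos ?_
    calc (2 : ℝ≥0)⁻¹ = 2⁻¹ - k + k := (tsub_add_cancel_of_le hk2.le).symm
      _ ≤ 2⁻¹ - k + (d : ℝ≥0)⁻¹ := by gcongr
  · push_cast
    rw [inv_inv, inv_inv, add_sub_cancel_right]
  · rw [← hk, ← ENNReal.coe_inv (by positivity), inv_inv, ← ENNReal.coe_add, hsk,
      ENNReal.coe_inv two_ne_zero, ENNReal.coe_ofNat]

theorem exists_eLpNorm_mul_fst_le (hd : 2 ≤ d) (hΩ : volume Ω ≠ ⊤) {κ : ℝ≥0∞} (hκ2 : 2 < κ)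
    (hκ : (d : ℝ≥0∞) ≤ κ) {q : Space d → ℂ} (hq : MemLp q κ (volume.restrict Ω)) :
    ∃ C : ℝ≥0, ∀ w ∈ sobolevH10 Ω,
      eLpNorm (fun x => q x * w.1 x) 2 (volume.restrict Ω) ≤ C * ∑ i, ‖w.2 i‖ₑ := by
  obtain ⟨p, s, hp1, hp2, hps, hκs⟩ := exists_sobolev_exponents hd hκ2 hκ
  obtain ⟨C, hC⟩ := IsTestFunction.exists_eLpNorm_le (by positivity) hΩ hp1 hp2 hps
  refine ⟨(eLpNorm q κ (volume.restrict Ω)).toNNReal * C, fun w hw => ?_⟩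
  rw [ENNReal.coe_mul, ENNReal.coe_toNNReal hq.eLpNorm_ne_top, mul_assoc]
  refine (eLpNorm_smul_le_mul_eLpNorm (p := κ) (q := s) (Lp.aestronglyMeasurable w.1) hq.1).trans ?_
  gcongr
  exact eLpNorm_fst_le_of_mem_sobolevH10 hC hw

end Sobolev

section FormDomain

variable {d : ℕ} {Ω : Set (Space d)}

/-- The Hilbert space `L²(Ω) × L²(Ω)ᵈ`, which contains `H¹(Ω)` as the set of pairs `(u, ∇u)`. -/
abbrev PairSpace (Ω : Set (Space d)) : Type := PiLp 2 fun _ : Option (Fin d) => L2 Ω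

/-- The components `(u, g)` of an element of `PairSpace`, in the form used by `sobolevH10`. -/
noncomputable def toPair (Ω : Set (Space d)) : PairSpace Ω →L[ℂ] L2 Ω × (Fin d → L2 Ω) :=
  (PiLp.proj 2 _ none).prod (ContinuousLinearMap.pi fun i => PiLp.proj 2 _ (some i))

/-- `H₀¹(Ω)` with its Hilbert space structure; `sobolevH10` itself lies in a product with the
maximum norm. -/
noncomputable def formDomain (Ω : Set (Space d)) : Submodule ℂ (PairSpace Ω) :=
  (sobolevH10 Ω).comap (toPair Ω).toLinearMap

/-- The embedding of `H₀¹(Ω)` into `L²(Ω)`. -/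
noncomputable def toL2 (Ω : Set (Space d)) : formDomain Ω →L[ℂ] L2 Ω :=
  PiLp.proj 2 _ none ∘L (formDomain Ω).subtypeL

/-- The `i`-th weak derivative on `H₀¹(Ω)`. -/
noncomputable def weakDeriv (Ω : Set (Space d)) (i : Fin d) : formDomain Ω →L[ℂ] L2 Ω :=
  PiLp.proj 2 _ (some i) ∘L (formDomain Ω).subtypeL

theorem pair_mem_sobolevH10 (u : formDomain Ω) : (toL2 Ω u, (weakDeriv Ω · u)) ∈ sobolevH10 Ω :=
  u.2

theorem exists_formDomain_eq {w : L2 Ω} {g : Fin d → L2 Ω} (h : (w, g) ∈ sobolevH10 Ω) :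
    ∃ u : formDomain Ω, toL2 Ω u = w ∧ (weakDeriv Ω · u) = g :=
  ⟨⟨WithLp.toLp 2 fun o => o.elim w g, h⟩, rfl, rfl⟩

theorem norm_sq_eq_toL2_add_weakDeriv (u : formDomain Ω) :
    ‖u‖ ^ 2 = ‖toL2 Ω u‖ ^ 2 + ∑ i, ‖weakDeriv Ω i u‖ ^ 2 := by
  rw [Submodule.coe_norm, PiLp.norm_sq_eq_of_L2, Fintype.sum_option]
  rfl

theorem norm_toL2_le (u : formDomain Ω) : ‖toL2 Ω u‖ ≤ ‖u‖ :=
  PiLp.norm_apply_le (u : PairSpace Ω) none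

theorem norm_weakDeriv_le (i : Fin d) (u : formDomain Ω) : ‖weakDeriv Ω i u‖ ≤ ‖u‖ :=
  PiLp.norm_apply_le (u : PairSpace Ω) (some i)

theorem continuous_integral_mul {X : Type*} [MeasurableSpace X] {μ : Measure X} {g : X → ℂ}
    (hg : MemLp g 2 μ) : Continuous fun u : Lp ℂ 2 μ => ∫ x, u x * g x ∂μ := by
  have hinner : ∀ u : Lp ℂ 2 μ, ∫ x, u x * g x ∂μ = ⟪hg.star.toLp _, u⟫_ℂ := fun u => by
    rw [L2.inner_def]
    refine integral_congr_ae ?_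
    filter_upwards [hg.star.coeFn_toLp] with x hx
    simp [hx]
  simp only [hinner]
  fun_prop

theorem isClosed_sobolevH1 : IsClosed (sobolevH1 Ω : Set (L2 Ω × (Fin d → L2 Ω))) := by
  have hinter : (sobolevH1 Ω : Set (L2 Ω × (Fin d → L2 Ω))) =
      ⋂ (φ : Space d → ℂ) (_ : IsTestFunction Ω φ) (i : Fin d),
        {w | ∫ x in Ω, w.1 x * partialDeriv i φ x = -∫ x in Ω, w.2 i x * φ x} := by
    ext w
    simp only [Set.mem_iInter]
    rfl
  rw [hinter]
  refine isClosed_iInter fun φ => isClosed_iInter fun hφ => isClosed_iInter fun i =>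
    isClosed_eq ?_ (Continuous.neg ?_)
  · exact (continuous_integral_mul (hφ.memLp_partialDeriv i 2 _)).comp continuous_fst
  · exact (continuous_integral_mul (hφ.memLp 2 _)).comp
      ((continuous_apply i).comp continuous_snd)

theorem isClosed_formDomain : IsClosed (formDomain Ω : Set (PairSpace Ω)) :=
  (isClosed_sobolevH1.inter (Submodule.isClosed_topologicalClosure _)).preimage
    (toPair Ω).continuous

instance : CompleteSpace (formDomain Ω) :=
  isClosed_formDomain.completeSpace_coe

theorem mk_mem_multiplication_graph {m : Space d → ℂ} {w v : L2 Ω}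
    (h : v =ᵐ[volume.restrict Ω] fun x => m x * w x) : (w, v) ∈ (multiplication Ω m).graph := by
  have hw : w ∈ multiplicationDomain Ω m := (Lp.memLp v).ae_eq h
  exact (LinearPMap.image_iff hw).1 (Lp.ext (h.trans (MemLp.coeFn_toLp hw).symm))

theorem exists_mul_norm_le_weakDeriv (hd : 2 ≤ d) (hΩ : volume Ω ≠ ⊤) {κ : ℝ≥0∞} (hκ2 : 2 < κ)
    (hκ : (d : ℝ≥0∞) ≤ κ) {q : Space d → ℂ} (hq : MemLp q κ (volume.restrict Ω)) :
    ∃ Q : formDomain Ω →L[ℂ] L2 Ω,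
      (∀ u, Q u =ᵐ[volume.restrict Ω] fun x => q x * toL2 Ω u x) ∧
      ∃ C : ℝ, ∀ u, ‖Q u‖ ≤ C * ∑ i, ‖weakDeriv Ω i u‖ := by
  obtain ⟨C, hC⟩ := exists_eLpNorm_mul_fst_le hd hΩ hκ2 hκ hq
  have hCu : ∀ u : formDomain Ω, eLpNorm (fun x => q x * toL2 Ω u x) 2 (volume.restrict Ω) ≤
      C * ∑ i, ‖weakDeriv Ω i u‖ₑ := fun u =>
    hC (toL2 Ω u, (weakDeriv Ω · u)) (pair_mem_sobolevH10 u)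
  have hfinite : ∀ u : formDomain Ω, C * ∑ i, ‖weakDeriv Ω i u‖ₑ < ⊤ := fun u =>
    ENNReal.mul_lt_top ENNReal.coe_lt_top (ENNReal.sum_lt_top.2 fun _ _ => enorm_lt_top)
  have hmem : ∀ u : formDomain Ω, toL2 Ω u ∈ multiplicationDomain Ω q := fun u =>
    ⟨hq.1.mul (Lp.aestronglyMeasurable _), (hCu u).trans_lt (hfinite u)⟩
  let Q : formDomain Ω →ₗ[ℂ] L2 Ω :=
    (multiplication Ω q).toFun ∘ₗ (toL2 Ω).toLinearMap.codRestrict (multiplicationDomain Ω q) hmem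
  have hQ : ∀ u, Q u =ᵐ[volume.restrict Ω] fun x => q x * toL2 Ω u x := fun u =>
    MemLp.coeFn_toLp (hmem u)
  have hbound : ∀ u, ‖Q u‖ ≤ C * ∑ i, ‖weakDeriv Ω i u‖ := by
    intro u
    have henorm : ‖Q u‖ₑ ≤ C * ∑ i, ‖weakDeriv Ω i u‖ₑ :=
      (Lp.enorm_def _).trans_le ((eLpNorm_congr_ae (hQ u)).trans_le (hCu u))
    have hreal := ENNReal.toReal_mono (hfinite u).ne henorm
    rw [ENNReal.toReal_mul, ENNReal.toReal_sum fun _ _ => enorm_ne_top] at hreal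
    simpa only [toReal_enorm, ENNReal.coe_toReal] using hreal
  refine ⟨Q.mkContinuous (C * d) fun u => ?_, hQ, C, hbound⟩
  calc ‖Q u‖ ≤ C * ∑ i, ‖weakDeriv Ω i u‖ := hbound u
    _ ≤ C * ∑ _i : Fin d, ‖u‖ := by
      gcongr with i
      exact norm_weakDeriv_le i u
    _ = C * d * ‖u‖ := by simp [mul_assoc]

theorem exists_norm_sq_le_weakDeriv (hd : 2 ≤ d) (hΩ : volume Ω ≠ ⊤) :
    ∃ C : ℝ, 0 < C ∧ ∀ u : formDomain Ω, ‖u‖ ^ 2 ≤ C * ∑ i, ‖weakDeriv Ω i u‖ ^ 2 := by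
  obtain ⟨Q, hQ, C, hC⟩ := exists_mul_norm_le_weakDeriv hd hΩ (ENNReal.ofNat_lt_top (n := 2)) le_top
    (memLp_top_const (1 : ℂ))
  refine ⟨C ^ 2 * d + 1, by positivity, fun u => ?_⟩
  have hQu : Q u = toL2 Ω u := Lp.ext (by simpa only [one_mul] using hQ u)
  have hsum : (∑ i, ‖weakDeriv Ω i u‖) ^ 2 ≤ d * ∑ i, ‖weakDeriv Ω i u‖ ^ 2 := by
    simpa using sq_sum_le_card_mul_sum_sq (s := Finset.univ) (f := fun i => ‖weakDeriv Ω i u‖)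
  calc ‖u‖ ^ 2 = ‖toL2 Ω u‖ ^ 2 + ∑ i, ‖weakDeriv Ω i u‖ ^ 2 := norm_sq_eq_toL2_add_weakDeriv u
    _ ≤ (C * ∑ i, ‖weakDeriv Ω i u‖) ^ 2 + ∑ i, ‖weakDeriv Ω i u‖ ^ 2 := by
      gcongr
      exact hQu ▸ hC u
    _ ≤ C ^ 2 * (d * ∑ i, ‖weakDeriv Ω i u‖ ^ 2) + ∑ i, ‖weakDeriv Ω i u‖ ^ 2 := by
      rw [mul_pow]
      gcongr
    _ = (C ^ 2 * d + 1) * ∑ i, ‖weakDeriv Ω i u‖ ^ 2 := by ring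

end FormDomain

section DirichletForm

variable {d : ℕ} {Ω : Set (Space d)} {a : Fin d → Fin d → Space d → ℝ} {c : ℝ}

/-- The bounded operator on `H₀¹(Ω)` that represents the form `a₀`. -/
noncomputable def gradOperator (ha : ∀ i j, MemLp (a i j) ∞ (volume.restrict Ω)) :
    formDomain Ω →L[ℂ] formDomain Ω :=
  ∑ i, ∑ j, (weakDeriv Ω j).adjoint ∘L mulOperator (m := fun x => (a i j x : ℂ)) (ha i j).ofReal ∘L
    weakDeriv Ω i

theorem formIntegrand_ae_eq_inner (ha : ∀ i j, MemLp (a i j) ∞ (volume.restrict Ω))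
    (g h : Fin d → L2 Ω) (i j : Fin d) :
    formIntegrand a g h i j =ᵐ[volume.restrict Ω] fun x =>
      ⟪h j x, mulOperator (m := fun x => (a i j x : ℂ)) (ha i j).ofReal (g i) x⟫_ℂ := by
  filter_upwards [coeFn_mulOperator (m := fun x => (a i j x : ℂ)) (ha i j).ofReal (g i)] with x hx
  rw [hx, RCLike.inner_apply, formIntegrand]

theorem integrable_formIntegrand (ha : ∀ i j, MemLp (a i j) ∞ (volume.restrict Ω))
    (g h : Fin d → L2 Ω) (i j : Fin d) :
    Integrable (formIntegrand a g h i j) (volume.restrict Ω) :=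
  (L2.integrable_inner _ _).congr (formIntegrand_ae_eq_inner ha g h i j).symm

theorem inner_mulOperator_eq_integral (ha : ∀ i j, MemLp (a i j) ∞ (volume.restrict Ω))
    (g h : Fin d → L2 Ω) (i j : Fin d) :
    ⟪h j, mulOperator (m := fun x => (a i j x : ℂ)) (ha i j).ofReal (g i)⟫_ℂ =
      ∫ x in Ω, formIntegrand a g h i j x := by
  rw [L2.inner_def]
  exact integral_congr_ae (formIntegrand_ae_eq_inner ha g h i j).symm

theorem inner_gradOperator (ha : ∀ i j, MemLp (a i j) ∞ (volume.restrict Ω))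
    (u v : formDomain Ω) :
    ⟪v, gradOperator ha u⟫_ℂ = form a (weakDeriv Ω · u) (weakDeriv Ω · v) := by
  simp only [form, ← inner_mulOperator_eq_integral ha, gradOperator, FunLike.coe_sum,
    Finset.sum_apply, inner_sum, ContinuousLinearMap.comp_apply,
    ContinuousLinearMap.adjoint_inner_right]

theorem isFormOperator_dirichletOperator (hΩ : IsOpen Ω)
    (ha : ∀ i j, MemLp (a i j) ∞ (volume.restrict Ω)) :
    IsFormOperator (toL2 Ω) (gradOperator ha) (dirichletOperator Ω a) := by
  intro w f
  rw [dirichletOperator_graph hΩ]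
  constructor
  · rintro ⟨g, hg, hform⟩
    obtain ⟨u, hu, rfl⟩ := exists_formDomain_eq hg
    refine ⟨u, hu, ext_inner_left ℂ fun v => ?_⟩
    rw [inner_gradOperator, ContinuousLinearMap.adjoint_inner_right]
    exact (hform _ _ (pair_mem_sobolevH10 v)).2
  · rintro ⟨u, rfl, hu⟩
    refine ⟨_, pair_mem_sobolevH10 u, fun v h hv => ⟨integrable_formIntegrand ha _ h, ?_⟩⟩
    obtain ⟨v, rfl, rfl⟩ := exists_formDomain_eq hv
    rw [← inner_gradOperator ha, hu, ContinuousLinearMap.adjoint_inner_right]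

theorem ofReal_le_sum_mul_conj {A : Fin d → Fin d → ℝ} (hA : ∀ i j, A i j = A j i)
    (hc : ∀ ξ : Space d, c * ‖ξ‖ ^ 2 ≤ ∑ i, ∑ j, A i j * ξ i * ξ j) (z : Fin d → ℂ) :
    ((c * ∑ i, ‖z i‖ ^ 2 : ℝ) : ℂ) ≤ ∑ i, ∑ j, (A i j : ℂ) * z i * (starRingEnd ℂ) (z j) := by
  have hre := hc (WithLp.toLp 2 fun i => (z i).re)
  have him := hc (WithLp.toLp 2 fun i => (z i).im)
  simp only [EuclideanSpace.norm_sq_eq, Real.norm_eq_abs, sq_abs] at hre him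
  refine Complex.le_def.2 ⟨?_, ?_⟩
  · calc c * ∑ i, ‖z i‖ ^ 2 = c * ∑ i, (z i).re ^ 2 + c * ∑ i, (z i).im ^ 2 := by
          simp only [← mul_add, ← Finset.sum_add_distrib, Complex.sq_norm, Complex.normSq_apply,
            ← sq]
      _ ≤ _ := add_le_add hre him
      _ = (∑ i, ∑ j, (A i j : ℂ) * z i * (starRingEnd ℂ) (z j)).re := by
          simp [Complex.mul_re, Finset.sum_add_distrib]
  · rw [Complex.ofReal_im, eq_comm, ← Complex.conj_eq_iff_im]
    simp only [map_sum, map_mul, Complex.conj_ofReal, Complex.conj_conj]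
    rw [Finset.sum_comm]
    refine Finset.sum_congr rfl fun i _ => Finset.sum_congr rfl fun j _ => ?_
    rw [hA j i]
    ring

theorem le_inner_gradOperator (ha : ∀ i j, MemLp (a i j) ∞ (volume.restrict Ω))
    (hsymm : ∀ i j, ∀ᵐ x ∂(volume.restrict Ω), a i j x = a j i x)
    (hc : ∀ᵐ x ∂(volume.restrict Ω), ∀ ξ : Space d,
      c * ‖ξ‖ ^ 2 ≤ ∑ i, ∑ j, a i j x * ξ i * ξ j) (u : formDomain Ω) :
    ((c * ∑ i, ‖weakDeriv Ω i u‖ ^ 2 : ℝ) : ℂ) ≤ ⟪u, gradOperator ha u⟫_ℂ := by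
  set g : Fin d → L2 Ω := (weakDeriv Ω · u)
  have hint := integrable_formIntegrand ha g g
  have hnorm : ∀ i, Integrable (fun x => ⟪g i x, g i x⟫_ℂ) (volume.restrict Ω) :=
    fun i => L2.integrable_inner (g i) (g i)
  have hnorm_sq : ∀ i, ((‖g i‖ ^ 2 : ℝ) : ℂ) = ∫ x in Ω, ⟪g i x, g i x⟫_ℂ := fun i => by
    rw [← L2.inner_def, inner_self_eq_norm_sq_to_K, Complex.ofReal_pow]
    rfl
  have hnorm_integral : ((c * ∑ i, ‖g i‖ ^ 2 : ℝ) : ℂ) =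
      ∫ x in Ω, (c : ℂ) * ∑ i, ⟪g i x, g i x⟫_ℂ := by
    rw [integral_const_mul, integral_finsetSum _ fun i _ => hnorm i, Complex.ofReal_mul,
      Complex.ofReal_sum, Finset.sum_congr rfl fun i _ => hnorm_sq i]
  have hform : ⟪u, gradOperator ha u⟫_ℂ = ∫ x in Ω, ∑ i, ∑ j, formIntegrand a g g i j x := by
    rw [inner_gradOperator, form, integral_finsetSum _ fun i _ =>
      integrable_finsetSum _ fun j _ => hint i j]
    exact Finset.sum_congr rfl fun i _ => (integral_finsetSum _ fun j _ => hint i j).symm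
  rw [hform, hnorm_integral]
  refine integral_mono_ae ((integrable_finsetSum _ fun i _ => hnorm i).const_mul _)
    (integrable_finsetSum _ fun i _ => integrable_finsetSum _ fun j _ => hint i j) ?_
  filter_upwards [ae_all_iff.2 fun i => ae_all_iff.2 (hsymm i), hc] with x hsymm_x hc_x
  have hpointwise := ofReal_le_sum_mul_conj hsymm_x hc_x fun i => g i x
  rw [Complex.ofReal_mul, Complex.ofReal_sum] at hpointwise
  simp only [inner_self_eq_norm_sq_to_K, Complex.ofReal_pow] at hpointwise ⊢
  exact hpointwise

end DirichletForm

section SchrodingerOperator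

variable {d : ℕ} {Ω : Set (Space d)} {a : Fin d → Fin d → Space d → ℝ} {q ρ α : Space d → ℝ}
  {κ : ℝ≥0∞} {S : formDomain Ω →L[ℂ] formDomain Ω} {p : ℂ} {r β : ℝ}

theorem exists_norm_sq_le_inner_gradOperator (hd : 2 ≤ d) (hΩfin : volume Ω ≠ ⊤)
    (ha : ∀ i j, MemLp (a i j) ∞ (volume.restrict Ω))
    (hsymm : ∀ i j, ∀ᵐ x ∂(volume.restrict Ω), a i j x = a j i x)
    (hell : ∃ c : ℝ, 0 < c ∧ ∀ᵐ x ∂(volume.restrict Ω), ∀ ξ : Space d,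
      c * ‖ξ‖ ^ 2 ≤ ∑ i, ∑ j, a i j x * ξ i * ξ j) :
    ∃ c : ℝ, 0 < c ∧ ∀ u, ((c * ‖u‖ ^ 2 : ℝ) : ℂ) ≤ ⟪u, gradOperator ha u⟫_ℂ := by
  obtain ⟨c, hc, hell⟩ := hell
  obtain ⟨C, hC, hpoincare⟩ := exists_norm_sq_le_weakDeriv (Ω := Ω) hd hΩfin
  refine ⟨c / C, by positivity, fun u => ?_⟩
  refine le_trans (Complex.real_le_real.2 ?_) (le_inner_gradOperator ha hsymm hell u)
  rw [div_mul_eq_mul_div, div_le_iff₀ hC, mul_assoc, mul_comm _ C]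
  exact mul_le_mul_of_nonneg_left (hpoincare u) hc.le

theorem schrodingerOperator_domain (hd : 2 ≤ d) (hΩ : IsOpen Ω) (hΩfin : volume Ω ≠ ⊤)
    (ha : ∀ i j, MemLp (a i j) ∞ (volume.restrict Ω)) (hκ2 : 2 < κ) (hκ : (d : ℝ≥0∞) ≤ κ)
    (hq : MemLp q κ (volume.restrict Ω)) :
    (schrodingerOperator Ω a q).domain = (dirichletOperator Ω a).domain := by
  obtain ⟨Q, hQ, -⟩ := exists_mul_norm_le_weakDeriv hd hΩfin hκ2 hκ (hq.ofReal (K := ℂ))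
  exact (isFormOperator_dirichletOperator hΩ ha).domain_add
    fun u => mk_mem_multiplication_graph (hQ u)

theorem exists_coercive_isFormOperator_schrodingerOperator (hd : 2 ≤ d) (hΩ : IsOpen Ω)
    (hΩfin : volume Ω ≠ ⊤) (ha : ∀ i j, MemLp (a i j) ∞ (volume.restrict Ω))
    (hsymm : ∀ i j, ∀ᵐ x ∂(volume.restrict Ω), a i j x = a j i x)
    (hell : ∃ c : ℝ, 0 < c ∧ ∀ᵐ x ∂(volume.restrict Ω), ∀ ξ : Space d,
      c * ‖ξ‖ ^ 2 ≤ ∑ i, ∑ j, a i j x * ξ i * ξ j)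
    (hκ2 : 2 < κ) (hκ : (d : ℝ≥0∞) ≤ κ) (hq : MemLp q κ (volume.restrict Ω))
    (hq_nonneg : ∀ᵐ x ∂(volume.restrict Ω), 0 ≤ q x) :
    ∃ S : formDomain Ω →L[ℂ] formDomain Ω,
      IsFormOperator (toL2 Ω) S (schrodingerOperator Ω a q) ∧
      ∃ c : ℝ, 0 < c ∧ ∀ u, ((c * ‖u‖ ^ 2 : ℝ) : ℂ) ≤ ⟪u, S u⟫_ℂ := by
  obtain ⟨Q, hQ, -⟩ := exists_mul_norm_le_weakDeriv hd hΩfin hκ2 hκ (hq.ofReal (K := ℂ))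
  obtain ⟨c, hc, hcoercive⟩ := exists_norm_sq_le_inner_gradOperator hd hΩfin ha hsymm hell
  refine ⟨_, (isFormOperator_dirichletOperator hΩ ha).add
    fun u => mk_mem_multiplication_graph (hQ u), c, hc, fun u => ?_⟩
  have hQ_nonneg : 0 ≤ ⟪toL2 Ω u, Q u⟫_ℂ := by
    refine inner_nonneg_of_ae ?_
    filter_upwards [hQ u, hq_nonneg] with x hx hqx
    rw [hx, ← smul_eq_mul, inner_smul_right, inner_self_eq_norm_sq_to_K]
    exact mul_nonneg (Complex.zero_le_real.2 hqx) (by positivity)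
  rw [add_apply, inner_add_right, ContinuousLinearMap.comp_apply,
    ContinuousLinearMap.adjoint_inner_right]
  exact le_add_of_le_of_nonneg (hcoercive u) hQ_nonneg

theorem toL2_mem_powMul_graph (hρ : MemLp ρ ∞ (volume.restrict Ω))
    (hα : MemLp α ∞ (volume.restrict Ω)) (hp : p ≠ 0) (u : formDomain Ω) :
    (toL2 Ω u, (powMul hρ hα p ∘L toL2 Ω) u) ∈
      (multiplication Ω fun x => (ρ x : ℂ) * p ^ (α x : ℂ)).graph :=
  mk_mem_multiplication_graph (coeFn_powMul hρ hα hp _)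

theorem isFormOperator_pencil (hS : IsFormOperator (toL2 Ω) S (schrodingerOperator Ω a q))
    (hρ : MemLp ρ ∞ (volume.restrict Ω)) (hα : MemLp α ∞ (volume.restrict Ω)) (hp : p ≠ 0) :
    IsFormOperator (toL2 Ω) (pencilForm (toL2 Ω) S hρ hα p) (pencil Ω a q ρ α p) :=
  hS.add (toL2_mem_powMul_graph hρ hα hp)

theorem pencil_domain (hS : IsFormOperator (toL2 Ω) S (schrodingerOperator Ω a q))
    (hρ : MemLp ρ ∞ (volume.restrict Ω)) (hα : MemLp α ∞ (volume.restrict Ω)) (hp : p ≠ 0) :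
    (pencil Ω a q ρ α p).domain = (schrodingerOperator Ω a q).domain :=
  hS.domain_add (toL2_mem_powMul_graph hρ hα hp)

end SchrodingerOperator

section Polar

variable {r β : ℝ}

theorem norm_ofReal_mul_exp_I_mul (hr : 0 ≤ r) :
    ‖(r : ℂ) * Complex.exp (Complex.I * β)‖ = r := by
  rw [mul_comm Complex.I, norm_mul, Complex.norm_exp_ofReal_mul_I, mul_one,
    Complex.norm_of_nonneg hr]

theorem arg_ofReal_mul_exp_I_mul (hr : 0 < r) (hβ : β ∈ Set.Ioc (-Real.pi) Real.pi) :
    ((r : ℂ) * Complex.exp (Complex.I * β)).arg = β := by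
  rw [mul_comm Complex.I, Complex.exp_mul_I, Complex.arg_mul_cos_add_sin_mul_I hr hβ]

theorem ofReal_mul_exp_I_mul_mem_slitPlane (hr : 0 < r) (hβ : β ∈ Set.Ioo (-Real.pi) Real.pi) :
    (r : ℂ) * Complex.exp (Complex.I * β) ∈ Complex.slitPlane := by
  rw [Complex.mem_slitPlane_iff_arg, arg_ofReal_mul_exp_I_mul hr (Set.Ioo_subset_Ioc_self hβ)]
  exact ⟨hβ.2.ne, mul_ne_zero (Complex.ofReal_ne_zero.2 hr.ne') (Complex.exp_ne_zero _)⟩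

theorem ofReal_mul_exp_I_mul_cpow (hr : 0 < r) (hβ : β ∈ Set.Ioc (-Real.pi) Real.pi) (s : ℝ) :
    ((r : ℂ) * Complex.exp (Complex.I * β)) ^ (s : ℂ) =
      ((r ^ s : ℝ) : ℂ) * Complex.exp (Complex.I * β * s) := by
  have hne : (r : ℂ) * Complex.exp (Complex.I * β) ≠ 0 :=
    mul_ne_zero (Complex.ofReal_ne_zero.2 hr.ne') (Complex.exp_ne_zero _)
  have hlog : Complex.log (r * Complex.exp (Complex.I * β)) = Real.log r + Complex.I * β := by
    rw [Complex.log, norm_ofReal_mul_exp_I_mul hr.le, arg_ofReal_mul_exp_I_mul hr hβ,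
      mul_comm Complex.I]
  rw [Complex.cpow_def_of_ne_zero hne, hlog, add_mul, Complex.exp_add, Real.rpow_def_of_pos hr,
    Complex.ofReal_exp, Complex.ofReal_mul]

theorem polarPencil_eq_pencil {d : ℕ} (Ω : Set (Space d)) (a : Fin d → Fin d → Space d → ℝ)
    (q ρ α : Space d → ℝ) (hr : 0 < r) (hβ : β ∈ Set.Ioc (-Real.pi) Real.pi) :
    polarPencil Ω a q ρ α r β = pencil Ω a q ρ α (r * Complex.exp (Complex.I * β)) := by
  simp only [polarPencil, pencil, ofReal_mul_exp_I_mul_cpow hr hβ, mul_assoc]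

end Polar

end VariableOrder

theorem proposition2p1_general
    (d : ℕ) (hd : 2 ≤ d)
    (Ω : Set (VariableOrder.Space d)) (hΩopen : IsOpen Ω) (hΩne : Ω.Nonempty)
    (hΩfin : volume Ω ≠ ⊤)
    (a : Fin d → Fin d → VariableOrder.Space d → ℝ)
    (ha : ∀ i j, MemLp (a i j) ∞ (volume.restrict Ω))
    (hsymm : ∀ i j, ∀ᵐ x ∂(volume.restrict Ω), a i j x = a j i x)
    (hell : ∃ c : ℝ, 0 < c ∧ ∀ᵐ x ∂(volume.restrict Ω), ∀ ξ : VariableOrder.Space d,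
      c * ‖ξ‖ ^ 2 ≤ ∑ i, ∑ j, a i j x * ξ i * ξ j)
    (κ : ℝ≥0∞) (hκ2 : 2 < κ) (hκ : (d : ℝ≥0∞) ≤ κ)
    (q : VariableOrder.Space d → ℝ) (hq : MemLp q κ (volume.restrict Ω))
    (hq_nonneg : ∀ᵐ x ∂(volume.restrict Ω), 0 ≤ q x)
    (α ρ : VariableOrder.Space d → ℝ)
    (hα : MemLp α ∞ (volume.restrict Ω)) (hρ : MemLp ρ ∞ (volume.restrict Ω))
    (α₀ αM ρ₀ ρM : ℝ) (hα₀ : 0 < α₀) (hαM : αM < 1) (hρ₀ : 0 < ρ₀)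
    (hα_bound : ∀ᵐ x ∂(volume.restrict Ω), α₀ ≤ α x ∧ α x ≤ αM)
    (hρ_bound : ∀ᵐ x ∂(volume.restrict Ω), ρ₀ ≤ ρ x ∧ ρ x ≤ ρM) :
    (VariableOrder.schrodingerOperator Ω a q).domain
        = (VariableOrder.dirichletOperator Ω a).domain ∧
    ∃ R : ℂ → (VariableOrder.L2 Ω →L[ℂ] VariableOrder.L2 Ω),
      (∀ p ∈ Complex.slitPlane,
        VariableOrder.IsBoundedInverse (VariableOrder.pencil Ω a q ρ α p) (R p) ∧
        ∀ f, R p f ∈ (VariableOrder.dirichletOperator Ω a).domain) ∧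
      (∀ r : ℝ, 0 < r → ∀ β : ℝ, -Real.pi < β → β < Real.pi →
        VariableOrder.IsBoundedInverse (VariableOrder.polarPencil Ω a q ρ α r β)
          (R ((r : ℂ) * Complex.exp (Complex.I * (β : ℂ)))) ∧
        ‖R ((r : ℂ) * Complex.exp (Complex.I * (β : ℂ)))‖
          ≤ VariableOrder.resolventConst α₀ αM ρ₀ ρM r β * max (r ^ (-α₀)) (r ^ (-αM))) ∧
      DifferentiableOn ℂ R Complex.slitPlane ∧
      ∃ K : ℝ, ∀ p ∈ Complex.slitPlane, ‖R p‖ ≤ K := by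
  open VariableOrder in
  have hdom := schrodingerOperator_domain hd hΩopen hΩfin ha hκ2 hκ hq
  obtain ⟨S, hS, c, hc, hcoercive⟩ := exists_coercive_isFormOperator_schrodingerOperator hd hΩopen
    hΩfin ha hsymm hell hκ2 hκ hq hq_nonneg
  have : (ae (volume.restrict Ω)).NeBot :=
    ae_restrict_neBot.2 (hΩopen.measure_pos volume hΩne).ne'
  have hα_le : α₀ ≤ αM := hα_bound.exists.elim fun _ hx => hx.1.trans hx.2
  have hρ_le : ρ₀ ≤ ρM := hρ_bound.exists.elim fun _ hx => hx.1.trans hx.2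
  have hαM0 := hα₀.le.trans hα_le
  have hα_nonneg := hα_bound.mono fun _ hx => And.intro (hα₀.le.trans hx.1) hx.2
  have hρ_lower := hρ_bound.mono fun _ hx => hx.1
  have hρ_nonneg := hρ_lower.mono fun _ hx => hρ₀.le.trans hx
  have hT {p : ℂ} (hp : p ∈ Complex.slitPlane) := isInvertible_pencilForm (J := toL2 Ω) hρ hα hc
    hcoercive hα_nonneg hαM0 hαM hρ_nonneg (Complex.slitPlane_ne_zero hp)
  have hR {p : ℂ} (hp : p ∈ Complex.slitPlane) :=
    (isFormOperator_pencil hS hρ hα (Complex.slitPlane_ne_zero hp)).isBoundedInverse (hT hp)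
  refine ⟨hdom, fun p => formResolvent (toL2 Ω) (pencilForm (toL2 Ω) S hρ hα p),
    fun p hp => ⟨hR hp, fun f => ?_⟩, fun r hr β hβ hβ' => ?_, fun p hp => ?_,
    1 / (Real.cos (αM * Real.pi / 2) * c), fun p hp => ?_⟩
  · rw [← hdom, ← pencil_domain hS hρ hα (Complex.slitPlane_ne_zero hp)]
    exact ((hR hp).1 f).1
  · have hp := ofReal_mul_exp_I_mul_mem_slitPlane hr ⟨hβ, hβ'⟩
    refine ⟨polarPencil_eq_pencil Ω a q ρ α hr ⟨hβ, hβ'.le⟩ ▸ hR hp, ?_⟩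
    simpa only [norm_ofReal_mul_exp_I_mul hr.le, arg_ofReal_mul_exp_I_mul hr ⟨hβ, hβ'.le⟩] using
      norm_formResolvent_pencilForm_le_resolventConst hρ hα hc.le hcoercive hα₀ hα_le hαM hρ₀ hρ_le
        hα_bound hρ_lower hp (hT hp)
  · exact (differentiableAt_formResolvent_pencilForm hρ hα hp (hT hp)).differentiableWithinAt
  · exact norm_formResolvent_pencilForm_le hρ hα hc hcoercive hα_nonneg hαM0 hαM hρ_nonneg
      norm_toL2_le (Complex.slitPlane_ne_zero hp)

theorem proposition2p1
    (d : ℕ) (hd : 2 ≤ d)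
    (Ω : Set (VariableOrder.Space d)) (hΩopen : IsOpen Ω) (hΩconn : IsConnected Ω)
    (hΩbdd : Bornology.IsBounded Ω)
    (a : Fin d → Fin d → VariableOrder.Space d → ℝ)
    (ha : ∀ i j, MemLp (a i j) ∞ (volume.restrict Ω))
    (hsymm : ∀ i j, ∀ᵐ x ∂(volume.restrict Ω), a i j x = a j i x)
    (hell : ∃ c : ℝ, 0 < c ∧ ∀ᵐ x ∂(volume.restrict Ω), ∀ ξ : VariableOrder.Space d,
      c * ‖ξ‖ ^ 2 ≤ ∑ i, ∑ j, a i j x * ξ i * ξ j)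
    (κ : ℝ≥0∞) (hκ : (d : ℝ≥0∞) < κ)
    (q : VariableOrder.Space d → ℝ) (hq : MemLp q κ (volume.restrict Ω))
    (hq_nonneg : ∀ᵐ x ∂(volume.restrict Ω), 0 ≤ q x)
    (α ρ : VariableOrder.Space d → ℝ)
    (hα : MemLp α ∞ (volume.restrict Ω)) (hρ : MemLp ρ ∞ (volume.restrict Ω))
    (α₀ αM ρ₀ ρM : ℝ) (hα₀ : 0 < α₀) (hαM : αM < 1) (hρ₀ : 0 < ρ₀)
    (hα_bound : ∀ᵐ x ∂(volume.restrict Ω), α₀ ≤ α x ∧ α x ≤ αM)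
    (hρ_bound : ∀ᵐ x ∂(volume.restrict Ω), ρ₀ ≤ ρ x ∧ ρ x ≤ ρM) :
    (VariableOrder.schrodingerOperator Ω a q).domain
        = (VariableOrder.dirichletOperator Ω a).domain ∧
    ∃ R : ℂ → (VariableOrder.L2 Ω →L[ℂ] VariableOrder.L2 Ω),
      (∀ p ∈ Complex.slitPlane,
        VariableOrder.IsBoundedInverse (VariableOrder.pencil Ω a q ρ α p) (R p) ∧
        ∀ f, R p f ∈ (VariableOrder.dirichletOperator Ω a).domain) ∧
      (∀ r : ℝ, 0 < r → ∀ β : ℝ, -Real.pi < β → β < Real.pi →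
        VariableOrder.IsBoundedInverse (VariableOrder.polarPencil Ω a q ρ α r β)
          (R ((r : ℂ) * Complex.exp (Complex.I * (β : ℂ)))) ∧
        ‖R ((r : ℂ) * Complex.exp (Complex.I * (β : ℂ)))‖
          ≤ VariableOrder.resolventConst α₀ αM ρ₀ ρM r β * max (r ^ (-α₀)) (r ^ (-αM))) ∧
      DifferentiableOn ℂ R Complex.slitPlane ∧
      ∃ K : ℝ, ∀ p ∈ Complex.slitPlane, ‖R p‖ ≤ K := by
  exact proposition2p1_general d hd Ω hΩopen hΩconn.nonempty hΩbdd.measure_lt_top.ne a ha hsymm hell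
    κ (lt_of_le_of_lt (by exact_mod_cast hd) hκ) hκ.le q hq hq_nonneg α ρ hα hρ α₀ αM ρ₀ ρM hα₀ hαM
    hρ₀ hα_bound hρ_bound
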